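/- Let $(\Gamma_t)_{t\ge 0}$ be the standard Gamma process: $\Gamma_0=0$, the increments are independent, $\Gamma_t-\Gamma_s$ has the Gamma distribution with shape $t-s$ and rate $1$ for $0\le s<t$, and the paths are nondecreasing and right-continuous. Let $X_1,X_2,\dots$ be i.i.d. exponential random variables with mean $1$ (possibly on another probability space). Let $f:[0,\infty)\to[0,\infty)$ be monotonic (nondecreasing or nonincreasing), and put $$\Gamma_t f=\int_{(0,t]} f\,d\Gamma,\qquad \lambda_t f=\int_0^t f(x)\,dx,\qquad R_t=\frac{\Gamma_t f}{\lambda_t f}\quad(t>0),$$ the first integral being the pathwise Lebesgue--Stieltjes integral, and $$w_k=f(k),\qquad S_n=\sum_{k=1}^n w_kX_k,\qquad W_n=\sum_{k=1}^n w_k,\qquad R_n^{\mathrm d}=\frac{S_n}{W_n}\quad(n\ge 1),$$ where a quotient with denominator $0$ is read as $0$. Then the following equivalences hold, with $t\to\infty$ through the reals and $n\to\infty$ through the integers: 1. $R_t\to1$ in probability if and only if $R_n^{\mathrm d}\to1$ in probability; 2. for every $0<p<\infty$, $R_t\to1$ in $L^p$ (that is, $\mathbb E|R_t-1|^p\to0$)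 if and only if $R_n^{\mathrm d}\to1$ in $L^p$; 3. $R_t\to1$ almost surely if and only if $R_n^{\mathrm d}\to1$ almost surely. -/

import Mathlib

open MeasureTheory ProbabilityTheory Filter Topology Set
open scoped NNReal ENNReal

noncomputable section

/-- A path on `[0, ∞)` that is nondecreasing and right-continuous. -/
def IsIncreasingRightContinuous (γ : ℝ≥0 → ℝ) : Prop :=
  Monotone γ ∧ ∀ t, ContinuousWithinAt γ (Ici t) t

/-- A nondecreasing right-continuous path on `[0, ∞)`, extended to `(-∞, 0)` by its value at `0`,
as a Stieltjes function on the line. -/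
def pathStieltjes (γ : ℝ≥0 → ℝ) (h : IsIncreasingRightContinuous γ) : StieltjesFunction ℝ where
  toFun x := γ x.toNNReal
  mono' := h.1.comp (fun _ _ hxy => Real.toNNReal_mono hxy)
  right_continuous' x :=
    (h.2 x.toNNReal).comp continuous_real_toNNReal.continuousWithinAt
      (fun _ hy => Real.toNNReal_mono hy)

open Classical in
/-- The Lebesgue–Stieltjes measure `dγ` of a nondecreasing right-continuous path
(the zero measure for any other path). It has no mass on `(-∞, 0]`. -/
def pathMeasure (γ : ℝ≥0 → ℝ) : Measure ℝ :=
  if h : IsIncreasingRightContinuous γ then (pathStieltjes γ h).measure else 0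

/-- The standard Gamma process on `[0, ∞)`: it starts at `0`, has independent increments,
the increment over `[s, t]` has the Gamma distribution with shape `t - s` and rate `1`
(so that the value at time `1` is exponential with mean `1`), and almost all paths are
nondecreasing and right-continuous. -/
structure IsGammaProcess {Ω : Type*} [MeasurableSpace Ω] (Γ : ℝ≥0 → Ω → ℝ) (P : Measure Ω) :
    Prop where
  zero : ∀ᵐ ω ∂P, Γ 0 ω = 0
  indep : HasIndepIncrements Γ P
  law : ∀ s t : ℝ≥0, s < t → HasLaw (fun ω => Γ t ω - Γ s ω) (gammaMeasure (t - s : ℝ) 1) P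
  path : ∀ᵐ ω ∂P, IsIncreasingRightContinuous (fun t => Γ t ω)

/-- The pathwise stochastic integral `Γ_t f = ∫_{(0,t]} f dΓ`. -/
def gammaIntegral {Ω : Type*} (Γ : ℝ≥0 → Ω → ℝ) (f : ℝ → ℝ) (t : ℝ) (ω : Ω) : ℝ :=
  ∫ x in Ioc 0 t, f x ∂(pathMeasure fun s => Γ s ω)

/-- `R_t = Γ_t f / λ_t f`, where `λ_t f = ∫₀ᵗ f(x) dx`. -/
def gammaRatio {Ω : Type*} (Γ : ℝ≥0 → Ω → ℝ) (f : ℝ → ℝ) (t : ℝ) (ω : Ω) : ℝ :=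
  gammaIntegral Γ f t ω / ∫ x in (0 : ℝ)..t, f x

/-- `X 1, X 2, …` are independent standard exponential random variables (`X 0` plays no role). -/
structure IsIIDStdExponential {Ω : Type*} [MeasurableSpace Ω] (X : ℕ → Ω → ℝ) (P : Measure Ω) :
    Prop where
  indep : iIndepFun (fun k => X (k + 1)) P
  law : ∀ k, 1 ≤ k → HasLaw (X k) (expMeasure 1) P

/-- `S_n / W_n`, where `S_n = ∑_{k=1}^n w_k X_k` and `W_n = ∑_{k=1}^n w_k`. -/
def weightedRatio {Ω : Type*} (w : ℕ → ℝ) (X : ℕ → Ω → ℝ) (n : ℕ) (ω : Ω) : ℝ :=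
  (∑ k ∈ Finset.Icc 1 n, w k * X k ω) / ∑ k ∈ Finset.Icc 1 n, w k

end

/-!
Let `ξ k` be the increment of `Γ` over `(k - 1, k]`. The `ξ k` are i.i.d. standard exponential, and
for monotonic `f` the Riemann sums of mesh one sandwich `Γ_n f` between the weighted sums
`∑ f(k) ξ_k` and `∑ f(k) ξ_{k+1}`, up to the first and the last term. These two sums have the same
law as `∑ f(k) X_k`, although one is bounded above and the other below by `Γ_n f`; since each mode
of convergence to `0` is controlled by the positive and the negative parts separately, and only sees
the joint law, convergence passes between `Γ_n f / W_n` and `S_n / W_n`.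

This works as long as no single weight `w_k`, `k ≤ n`, is a fixed proportion of `W_n` infinitely
often: then `λ_n f ∼ W_n ∼ W_{n+1} → ∞`, so boundary terms and the choice of normalization do not
matter. Otherwise neither ratio converges in probability, hence in no other mode. For the weighted
sums, one exponential variable is large enough to push `S_n / W_n` above `2` with a fixed positive
probability. For the Gamma process, one unit interval carries a fixed proportion of `λ_t f`, and the
strict inequality `log (1 + x) < x` keeps the Laplace transform
`E exp (-R_t) ≥ exp (-∫₀ᵗ log (1 + f(x) / λ_t f) dx)` bounded away from `exp (-1)`.
-/

open Asymptotics

/-- The modes of convergence of the theorem: in measure, in `L^p` for `0 < p < ∞`, and almost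
everywhere. -/
inductive ConvMode
  | inMeasure
  | inLp (p : ℝ≥0∞) (ne_zero : p ≠ 0) (ne_top : p ≠ ∞)
  | ae

namespace ConvMode

/-- The family `Y` converges to `0` along `l` in the given mode. -/
def TendstoZero (m : ConvMode) {ι Ω : Type*} [MeasurableSpace Ω] (P : Measure Ω) (l : Filter ι)
    (Y : ι → Ω → ℝ) : Prop :=
  match m with
  | inMeasure => TendstoInMeasure P Y l (fun _ => 0)
  | inLp p _ _ => Tendsto (fun i => eLpNorm (Y i) p P) l (𝓝 0)
  | ae => ∀ᵐ ω ∂P, Tendsto (fun i => Y i ω) l (𝓝 0)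

variable {ι κ Ω Ω' : Type*} [MeasurableSpace Ω] [MeasurableSpace Ω'] {P : Measure Ω}
  {P' : Measure Ω'} {l : Filter ι} {m : ConvMode}

theorem tendstoZero_inMeasure_iff {Y : ι → Ω → ℝ} :
    inMeasure.TendstoZero P l Y ↔
      ∀ ε, 0 < ε → Tendsto (fun i => P {ω | ε ≤ |Y i ω|}) l (𝓝 0) := by
  simp [TendstoZero, tendstoInMeasure_iff_norm]

theorem TendstoZero.comp {Y : ι → Ω → ℝ} (hY : m.TendstoZero P l Y) {l' : Filter κ} {k : κ → ι}
    (hk : Tendsto k l' l) : m.TendstoZero P l' (fun j => Y (k j)) := by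
  cases m with
  | inMeasure => exact TendstoInMeasure.comp hY hk
  | inLp p _ _ =>
    simp only [TendstoZero] at hY ⊢
    exact hY.comp hk
  | ae =>
    simp only [TendstoZero] at hY ⊢
    filter_upwards [hY] with ω hω using hω.comp hk

theorem TendstoZero.mono {Y Z : ι → Ω → ℝ} (hZ : m.TendstoZero P l Z) {s : Set ι} (hs : s ∈ l)
    (h : ∀ᵐ ω ∂P, ∀ i ∈ s, |Y i ω| ≤ |Z i ω|) : m.TendstoZero P l Y := by
  cases m with
  | inMeasure =>
    rw [tendstoZero_inMeasure_iff] at hZ ⊢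
    intro ε hε
    refine tendsto_of_tendsto_of_tendsto_of_le_of_le' tendsto_const_nhds (hZ ε hε)
      (Eventually.of_forall fun _ => zero_le) ?_
    filter_upwards [hs] with i hi
    refine measure_mono_ae ?_
    filter_upwards [h] with ω hω hε using le_trans hε (hω i hi)
  | inLp p _ _ =>
    refine tendsto_of_tendsto_of_tendsto_of_le_of_le' tendsto_const_nhds hZ
      (Eventually.of_forall fun _ => zero_le) ?_
    filter_upwards [hs] with i hi
    refine eLpNorm_mono_ae ?_
    filter_upwards [h] with ω hω using hω i hi
  | ae =>
    simp only [TendstoZero] at hZ ⊢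
    filter_upwards [hZ, h] with ω hZω hω
    refine squeeze_zero_norm' ?_ (by simpa using hZω.abs)
    filter_upwards [hs] with i hi using hω i hi

theorem TendstoZero.congr {Y Z : ι → Ω → ℝ} (hZ : m.TendstoZero P l Z) {s : Set ι} (hs : s ∈ l)
    (h : ∀ᵐ ω ∂P, ∀ i ∈ s, Y i ω = Z i ω) : m.TendstoZero P l Y := by
  refine hZ.mono hs ?_
  filter_upwards [h] with ω hω i hi
  rw [hω i hi]

theorem TendstoZero.add {Y Z : ι → Ω → ℝ} (hY : m.TendstoZero P l Y) (hZ : m.TendstoZero P l Z)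
    (mY : ∀ i, AEMeasurable (Y i) P) (mZ : ∀ i, AEMeasurable (Z i) P) :
    m.TendstoZero P l (fun i ω => Y i ω + Z i ω) := by
  cases m with
  | inMeasure =>
    rw [tendstoZero_inMeasure_iff] at hY hZ ⊢
    intro ε hε
    have hsum := (hY (ε / 2) (by positivity)).add (hZ (ε / 2) (by positivity))
    rw [add_zero] at hsum
    refine tendsto_of_tendsto_of_tendsto_of_le_of_le tendsto_const_nhds hsum
      (fun _ => zero_le) fun i => (measure_mono ?_).trans (measure_union_le _ _)
    intro ω (hω : ε ≤ |Y i ω + Z i ω|)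
    by_contra hc
    simp only [mem_union, mem_ofPred_eq, not_or, not_le] at hc
    linarith [abs_add_le (Y i ω) (Z i ω)]
  | inLp p _ _ =>
    have hsum := ENNReal.Tendsto.const_mul (a := ENNReal.LpAddConst p) (Tendsto.add hY hZ)
      (Or.inr (ENNReal.LpAddConst_lt_top p).ne)
    rw [add_zero, mul_zero] at hsum
    exact tendsto_of_tendsto_of_tendsto_of_le_of_le tendsto_const_nhds hsum
      (fun _ => zero_le) fun i => eLpNorm_add_le' (mY i).aestronglyMeasurable
        (mZ i).aestronglyMeasurable p
  | ae =>
    simp only [TendstoZero] at hY hZ ⊢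
    filter_upwards [hY, hZ] with ω hYω hZω
    simpa using hYω.add hZω

theorem TendstoZero.const_mul {Y : ι → Ω → ℝ} (hY : m.TendstoZero P l Y) (c : ℝ) :
    m.TendstoZero P l (fun i ω => c * Y i ω) := by
  cases m with
  | inMeasure =>
    rw [tendstoZero_inMeasure_iff] at hY ⊢
    intro ε hε
    refine tendsto_of_tendsto_of_tendsto_of_le_of_le tendsto_const_nhds
      (hY (ε / (|c| + 1)) (by positivity)) (fun _ => zero_le) fun i => measure_mono ?_
    intro ω (hω : ε ≤ |c * Y i ω|)
    change ε / (|c| + 1) ≤ |Y i ω|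
    rw [div_le_iff₀ (by positivity)]
    rw [abs_mul] at hω
    nlinarith [abs_nonneg (Y i ω)]
  | inLp p _ _ =>
    have hc := ENNReal.Tendsto.const_mul (a := ‖c‖ₑ) hY (Or.inr enorm_ne_top)
    rw [mul_zero] at hc
    exact hc.congr fun i => (eLpNorm_const_smul c (Y i) p P).symm
  | ae =>
    simp only [TendstoZero] at hY ⊢
    filter_upwards [hY] with ω hω
    simpa using hω.const_mul c

theorem TendstoZero.mul_of_tendsto {Y : ι → Ω → ℝ} (hY : m.TendstoZero P l Y) {u : ι → ℝ} {c : ℝ}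
    (hu : Tendsto u l (𝓝 c)) : m.TendstoZero P l (fun i ω => u i * Y i ω) := by
  have hbound : {i | |u i| ≤ |c| + 1} ∈ l := by
    filter_upwards [hu.abs.eventually_lt_const (lt_add_one |c|)] with i hi using hi.le
  refine (hY.const_mul (|c| + 1)).mono hbound (ae_of_all _ fun ω i hi => ?_)
  rw [abs_mul, abs_mul]
  exact mul_le_mul_of_nonneg_right (le_trans hi (le_abs_self _)) (abs_nonneg _)

theorem TendstoZero.squeeze {X Y Z : ι → Ω → ℝ} (hY : m.TendstoZero P l Y)
    (hZ : m.TendstoZero P l Z) (mY : ∀ i, AEMeasurable (Y i) P) (mZ : ∀ i, AEMeasurable (Z i) P)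
    {s : Set ι} (hs : s ∈ l) (h : ∀ᵐ ω ∂P, ∀ i ∈ s, Y i ω ≤ X i ω ∧ X i ω ≤ Z i ω) :
    m.TendstoZero P l X := by
  have habs {V : ι → Ω → ℝ} (hV : m.TendstoZero P l V) :
      m.TendstoZero P l (fun i ω => |V i ω|) :=
    hV.mono univ_mem (ae_of_all _ fun ω i _ => (abs_abs _).le)
  refine ((habs hY).add (habs hZ) (fun i => (mY i).abs) (fun i => (mZ i).abs)).mono hs ?_
  filter_upwards [h] with ω hω i hi
  calc |X i ω| ≤ max |Y i ω| |Z i ω| := abs_le_max_abs_abs (hω i hi).1 (hω i hi).2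
    _ ≤ |Y i ω| + |Z i ω| := max_le_add_of_nonneg (abs_nonneg _) (abs_nonneg _)
    _ ≤ |(|Y i ω| + |Z i ω|)| := le_abs_self _

theorem TendstoZero.of_identDistrib {E : Type*} [MeasurableSpace E] {U : Ω → E} {V : Ω' → E}
    (h : IdentDistrib U V P P') {g : ℕ → E → ℝ} (hg : ∀ n, Measurable (g n))
    (hU : m.TendstoZero P atTop (fun n ω => g n (U ω))) :
    m.TendstoZero P' atTop (fun n ω => g n (V ω)) := by
  cases m with
  | inMeasure =>
    rw [tendstoZero_inMeasure_iff] at hU ⊢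
    exact fun ε hε => (hU ε hε).congr fun n =>
      h.measure_mem_eq (s := {x | ε ≤ |g n x|}) (measurableSet_le measurable_const (hg n).abs)
  | inLp p _ _ => exact Tendsto.congr (fun n => (h.comp (hg n)).eLpNorm_eq p) hU
  | ae =>
    exact h.ae_snd (p := fun x => Tendsto (fun n => g n x) atTop (𝓝 0))
      (measurableSet_tendsto _ hg) hU

theorem TendstoZero.squeeze_identDistrib {E : Type*} [MeasurableSpace E] {U V : Ω → E}
    (h : IdentDistrib U V P P) {g : ℕ → E → ℝ} (hg : ∀ n, Measurable (g n)) {Y Z : ℕ → Ω → ℝ}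
    (hY : m.TendstoZero P atTop Y) (hZ : m.TendstoZero P atTop Z)
    (hYU : ∀ᵐ ω ∂P, ∀ n, Y n ω ≤ g n (U ω)) (hVZ : ∀ᵐ ω ∂P, ∀ n, g n (V ω) ≤ Z n ω) :
    m.TendstoZero P atTop (fun n ω => g n (U ω)) := by
  have hmin : m.TendstoZero P atTop (fun n ω => min (g n (U ω)) 0) := by
    refine hY.mono univ_mem ?_
    filter_upwards [hYU] with ω hω n _
    rw [abs_of_nonpos (min_le_right _ _)]
    exact (neg_le_neg (min_le_min_right 0 (hω n))).trans
      (by rcases le_total (Y n ω) 0 with h | h <;> simp [h, neg_le_abs])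
  have hmax : m.TendstoZero P atTop (fun n ω => max (g n (U ω)) 0) := by
    refine TendstoZero.of_identDistrib (g := fun n x => max (g n x) 0) h.symm
      (fun n => (hg n).max measurable_const) (hZ.mono univ_mem ?_)
    filter_upwards [hVZ] with ω hω n _
    rw [abs_of_nonneg (le_max_right _ _)]
    exact max_le ((hω n).trans (le_abs_self _)) (abs_nonneg _)
  have mU (n : ℕ) : AEMeasurable (fun ω => g n (U ω)) P :=
    (hg n).comp_aemeasurable h.aemeasurable_fst
  exact hmin.squeeze hmax (fun n => (mU n).min aemeasurable_const)
    (fun n => (mU n).max aemeasurable_const) univ_mem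
    (ae_of_all _ fun ω n _ => ⟨min_le_left _ _, le_max_left _ _⟩)

section FiniteMeasure

variable [IsFiniteMeasure P] [l.IsCountablyGenerated]

theorem TendstoZero.inMeasure {Y : ι → Ω → ℝ} (hY : m.TendstoZero P l Y)
    (mY : ∀ i, AEMeasurable (Y i) P) : inMeasure.TendstoZero P l Y := by
  cases m with
  | inMeasure => exact hY
  | inLp p hp0 _ =>
    refine tendstoInMeasure_of_tendsto_eLpNorm hp0 (fun i => (mY i).aestronglyMeasurable)
      aestronglyMeasurable_const (Tendsto.congr (fun i => ?_) hY)
    congr 1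
    ext ω
    simp
  | ae =>
    refine tendstoInMeasure_of_ne_top fun ε hε _ => tendsto_of_seq_tendsto fun x hx => ?_
    refine tendstoInMeasure_of_tendsto_ae (fun n => (mY (x n)).aestronglyMeasurable) ?_ ε hε
    filter_upwards [hY] with ω hω using hω.comp hx

theorem tendstoZero_mul_memLp {u : ι → ℝ} (hu : Tendsto u l (𝓝 0)) {ξ : Ω → ℝ}
    (hξ : ∀ p : ℝ≥0∞, p ≠ ∞ → MemLp ξ p P) : m.TendstoZero P l (fun i ω => u i * ξ ω) := by
  have hae : ae.TendstoZero P l (fun i ω => u i * ξ ω) :=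
    ae_of_all _ fun ω => by simpa using hu.mul_const (ξ ω)
  cases m with
  | inMeasure => exact hae.inMeasure fun i => ((hξ 0 (by simp)).1.aemeasurable.const_mul _)
  | inLp p _ hp =>
    have hmul := ENNReal.Tendsto.mul_const (b := eLpNorm ξ p P) hu.enorm
      (Or.inr (hξ p hp).eLpNorm_ne_top)
    rw [enorm_zero, zero_mul] at hmul
    exact hmul.congr fun i => (eLpNorm_const_smul (u i) ξ p P).symm
  | ae => exact hae

theorem tendstoZero_const {u : ι → ℝ} (hu : Tendsto u l (𝓝 0)) :
    m.TendstoZero P l (fun i (_ : Ω) => u i) := by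
  simpa using tendstoZero_mul_memLp (m := m) hu (P := P) (ξ := fun _ => 1)
    (fun p _ => memLp_const 1)

theorem TendstoZero.div_sub_one_of_isEquivalent {F : ι → Ω → ℝ} {u v : ι → ℝ} (huv : u ~[l] v)
    (mF : ∀ i, AEMeasurable (F i) P)
    (h : m.TendstoZero P l (fun i ω => F i ω / u i - 1)) :
    m.TendstoZero P l (fun i ω => F i ω / v i - 1) := by
  obtain ⟨φ, hφ, huφ⟩ := huv.exists_eq_mul
  have hφ0 : Tendsto (fun i => φ i - 1) l (𝓝 0) := by simpa using hφ.sub_const 1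
  have hsum := (h.mul_of_tendsto hφ).add (tendstoZero_const (m := m) (P := P) hφ0)
    (fun i => (((mF i).div_const _).sub_const 1).const_mul _) (fun _ => aemeasurable_const)
  refine hsum.congr (inter_mem huφ (hφ.eventually_ne one_ne_zero))
    (ae_of_all _ fun ω i ⟨hui, hφi⟩ => ?_)
  have hdiv : F i ω / v i = φ i * (F i ω / u i) := by
    rw [hui, Pi.mul_apply, ← mul_div_assoc, mul_div_mul_left _ _ hφi]
  rw [hdiv]
  ring

theorem TendstoZero.div_sub_one_of_monotoneOn {F : ℝ → Ω → ℝ} {Λ : ℝ → ℝ}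
    (h : m.TendstoZero P atTop (fun n : ℕ => fun ω => F n ω / Λ n - 1))
    (mF : ∀ t, AEMeasurable (F t) P) (hF : ∀ᵐ ω ∂P, MonotoneOn (fun t => F t ω) (Ici 0))
    (hF0 : ∀ᵐ ω ∂P, ∀ t, 0 ≤ F t ω) (hΛ : MonotoneOn Λ (Ici 0))
    (hΛ_pos : ∀ᶠ n : ℕ in atTop, 0 < Λ n)
    (hΛ_succ : (fun n : ℕ => Λ (n + 1)) ~[atTop] fun n => Λ n) :
    m.TendstoZero P atTop (fun t ω => F t ω / Λ t - 1) := by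
  have hfloor : Tendsto (fun t : ℝ => ⌊t⌋₊) atTop atTop := tendsto_nat_floor_atTop
  have hlower := (h.div_sub_one_of_isEquivalent hΛ_succ.symm fun n => mF n).comp hfloor
  have hsucc : m.TendstoZero P atTop (fun n : ℕ => fun ω => F (n + 1) ω / Λ (n + 1) - 1) := by
    simpa using h.comp (tendsto_add_atTop_nat 1)
  have hupper := (hsucc.div_sub_one_of_isEquivalent hΛ_succ fun n => mF _).comp hfloor
  refine hlower.squeeze hupper (fun t => ((mF _).div_const _).sub_const 1)
    (fun t => ((mF _).div_const _).sub_const 1)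
    (inter_mem (Ici_mem_atTop 0) (hfloor.eventually hΛ_pos)) ?_
  filter_upwards [hF, hF0] with ω hω hω0 t ⟨(ht : 0 ≤ t), (hpos : 0 < Λ ⌊t⌋₊)⟩
  have hn : (0 : ℝ) ≤ (⌊t⌋₊ : ℝ) := Nat.cast_nonneg _
  have hn1 : (0 : ℝ) ≤ (⌊t⌋₊ : ℝ) + 1 := by positivity
  have hle : (⌊t⌋₊ : ℝ) ≤ t := Nat.floor_le ht
  have hlt : t ≤ (⌊t⌋₊ : ℝ) + 1 := (Nat.lt_floor_add_one t).le
  have hΛt : 0 < Λ t := hpos.trans_le (hΛ hn ht hle)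
  exact ⟨sub_le_sub_right (div_le_div₀ (hω0 t) (hω hn ht hle) hΛt (hΛ ht hn1 hlt)) 1,
    sub_le_sub_right (div_le_div₀ (hω0 _) (hω ht hn1 hlt) hpos (hΛ hn ht hle)) 1⟩

end FiniteMeasure

end ConvMode

section RiemannSums

variable {f : ℝ → ℝ} {μ : Measure ℝ} [IsLocallyFiniteMeasure μ]

theorem intervalIntegrable_of_monotoneOn_or_antitoneOn
    (hf : MonotoneOn f (Ici 0) ∨ AntitoneOn f (Ici 0)) {a b : ℝ} (ha : 0 ≤ a) (hb : 0 ≤ b) :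
    IntervalIntegrable f μ a b := by
  have hsub : uIcc a b ⊆ Ici 0 := fun x hx => (le_inf ha hb).trans hx.1
  exact hf.elim (fun h => (h.mono hsub).intervalIntegrable)
    (fun h => (h.mono hsub).intervalIntegrable)

theorem monotoneOn_intervalIntegral (hf0 : ∀ x, 0 ≤ x → 0 ≤ f x)
    (hf : MonotoneOn f (Ici 0) ∨ AntitoneOn f (Ici 0)) :
    MonotoneOn (fun t => ∫ x in (0 : ℝ)..t, f x ∂μ) (Ici 0) := by
  intro s (hs : 0 ≤ s) t (ht : 0 ≤ t) hst
  refine intervalIntegral.integral_mono_interval le_rfl hs hst ?_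
    (intervalIntegrable_of_monotoneOn_or_antitoneOn hf le_rfl ht)
  filter_upwards [ae_restrict_mem measurableSet_Ioc] with x hx using hf0 x hx.1.le

theorem intervalIntegral_le_sum_mul_measureReal_Ioc {u c : ℕ → ℝ} (hu : Monotone u) (n : ℕ)
    (hf : ∀ i, IntervalIntegrable f μ (u i) (u (i + 1)))
    (h : ∀ i, ∀ x ∈ Ioc (u i) (u (i + 1)), f x ≤ c i) :
    ∫ x in u 0..u n, f x ∂μ ≤
      ∑ i ∈ Finset.range n, c i * μ.real (Ioc (u i) (u (i + 1))) := by
  rw [← intervalIntegral.sum_integral_adjacent_intervals fun i _ => hf i]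
  refine Finset.sum_le_sum fun i _ => ?_
  rw [intervalIntegral.integral_of_le (hu i.le_succ)]
  refine (setIntegral_mono_on (hf i).1 (integrableOn_const measure_Ioc_lt_top.ne)
    measurableSet_Ioc (h i)).trans_eq ?_
  rw [setIntegral_const, smul_eq_mul, mul_comm]

theorem integral_le_sum_of_monotoneOn (hf : MonotoneOn f (Ici 0)) (n : ℕ) :
    ∫ x in (0 : ℝ)..n, f x ∂μ ≤
      ∑ i ∈ Finset.range n, f (i + 1 : ℕ) * μ.real (Ioc (i : ℝ) (i + 1 : ℕ)) := by
  have h := intervalIntegral_le_sum_mul_measureReal_Ioc (u := fun i : ℕ => (i : ℝ))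
    (μ := μ) (f := f) (c := fun i => f (i + 1 : ℕ)) Nat.mono_cast n
    (fun i => intervalIntegrable_of_monotoneOn_or_antitoneOn (.inl hf) i.cast_nonneg
      (i + 1).cast_nonneg)
    (fun i x hx => hf (mem_Ici.2 (i.cast_nonneg.trans hx.1.le))
      (mem_Ici.2 (i + 1).cast_nonneg) hx.2)
  simpa using h

theorem integral_le_sum_of_antitoneOn (hf : AntitoneOn f (Ici 0)) (n : ℕ) :
    ∫ x in (0 : ℝ)..n, f x ∂μ ≤
      ∑ i ∈ Finset.range n, f i * μ.real (Ioc (i : ℝ) (i + 1 : ℕ)) := by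
  have h := intervalIntegral_le_sum_mul_measureReal_Ioc (u := fun i : ℕ => (i : ℝ))
    (μ := μ) (f := f) (c := fun i => f i) Nat.mono_cast n
    (fun i => intervalIntegrable_of_monotoneOn_or_antitoneOn (.inr hf) i.cast_nonneg
      (i + 1).cast_nonneg)
    (fun i x hx => hf (mem_Ici.2 i.cast_nonneg)
      (mem_Ici.2 (i.cast_nonneg.trans hx.1.le)) hx.1.le)
  simpa using h

theorem sum_le_integral_of_monotoneOn (hf : MonotoneOn f (Ici 0)) (n : ℕ) :
    ∑ i ∈ Finset.range n, f i * μ.real (Ioc (i : ℝ) (i + 1 : ℕ)) ≤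
      ∫ x in (0 : ℝ)..n, f x ∂μ := by
  have h := integral_le_sum_of_antitoneOn (μ := μ) hf.neg n
  simp only [intervalIntegral.integral_neg, neg_mul, Finset.sum_neg_distrib] at h
  exact neg_le_neg_iff.1 h

theorem sum_le_integral_of_antitoneOn (hf : AntitoneOn f (Ici 0)) (n : ℕ) :
    ∑ i ∈ Finset.range n, f (i + 1 : ℕ) * μ.real (Ioc (i : ℝ) (i + 1 : ℕ)) ≤
      ∫ x in (0 : ℝ)..n, f x ∂μ := by
  have h := integral_le_sum_of_monotoneOn (μ := μ) hf.neg n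
  simp only [intervalIntegral.integral_neg, neg_mul, Finset.sum_neg_distrib] at h
  exact neg_le_neg_iff.1 h

end RiemannSums

section PathMeasure

instance isLocallyFiniteMeasure_pathMeasure (γ : ℝ≥0 → ℝ) :
    IsLocallyFiniteMeasure (pathMeasure γ) := by
  unfold pathMeasure
  split_ifs <;> infer_instance

theorem pathMeasure_Ioc {γ : ℝ≥0 → ℝ} (hγ : IsIncreasingRightContinuous γ) (a b : ℝ) :
    pathMeasure γ (Ioc a b) = ENNReal.ofReal (γ b.toNNReal - γ a.toNNReal) := by
  rw [pathMeasure, dif_pos hγ, StieltjesFunction.measure_Ioc]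
  rfl

theorem pathMeasure_real_Ioc {γ : ℝ≥0 → ℝ} (hγ : IsIncreasingRightContinuous γ) {s t : ℝ≥0}
    (hst : s ≤ t) : (pathMeasure γ).real (Ioc (s : ℝ) t) = γ t - γ s := by
  rw [measureReal_def, pathMeasure_Ioc hγ, Real.toNNReal_coe, Real.toNNReal_coe,
    ENNReal.toReal_ofReal (sub_nonneg.2 (hγ.1 hst))]

theorem gammaIntegral_eq_intervalIntegral {Ω : Type*} (Γ : ℝ≥0 → Ω → ℝ) (f : ℝ → ℝ) {t : ℝ}
    (ht : 0 ≤ t) (ω : Ω) :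
    gammaIntegral Γ f t ω = ∫ x in (0 : ℝ)..t, f x ∂pathMeasure fun s => Γ s ω :=
  (intervalIntegral.integral_of_le ht).symm

theorem gammaIntegral_nonneg {Ω : Type*} (Γ : ℝ≥0 → Ω → ℝ) {f : ℝ → ℝ}
    (hf0 : ∀ x, 0 ≤ x → 0 ≤ f x) (t : ℝ) (ω : Ω) : 0 ≤ gammaIntegral Γ f t ω :=
  setIntegral_nonneg measurableSet_Ioc fun x hx => hf0 x hx.1.le

theorem gammaRatio_nonneg {Ω : Type*} (Γ : ℝ≥0 → Ω → ℝ) {f : ℝ → ℝ}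
    (hf0 : ∀ x, 0 ≤ x → 0 ≤ f x) (t : ℝ) (ω : Ω) : 0 ≤ gammaRatio Γ f t ω := by
  rcases le_total 0 t with ht | ht
  · exact div_nonneg (gammaIntegral_nonneg Γ hf0 t ω)
      (intervalIntegral.integral_nonneg ht fun x hx => hf0 x hx.1)
  · simp [gammaRatio, gammaIntegral, Ioc_eq_empty_of_le ht]

theorem monotoneOn_gammaIntegral {Ω : Type*} (Γ : ℝ≥0 → Ω → ℝ) {f : ℝ → ℝ}
    (hf0 : ∀ x, 0 ≤ x → 0 ≤ f x) (hf : MonotoneOn f (Ici 0) ∨ AntitoneOn f (Ici 0)) (ω : Ω) :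
    MonotoneOn (fun t => gammaIntegral Γ f t ω) (Ici 0) :=
  (monotoneOn_intervalIntegral hf0 hf).congr fun _ ht =>
    (gammaIntegral_eq_intervalIntegral Γ f ht ω).symm

variable {Ω : Type*} [MeasurableSpace Ω] {Γ : ℝ≥0 → Ω → ℝ} {P : Measure Ω}

theorem IsGammaProcess.aemeasurable (hΓ : IsGammaProcess Γ P) (t : ℝ≥0) :
    AEMeasurable (Γ t) P := by
  rcases eq_or_lt_of_le (zero_le (a := t)) with rfl | ht
  · exact aemeasurable_const.congr (EventuallyEq.symm hΓ.zero)
  · refine (hΓ.law 0 t ht).aemeasurable.congr ?_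
    filter_upwards [hΓ.zero] with ω hω
    rw [hω, sub_zero]

theorem IsGammaProcess.aemeasurable_pathMeasure_Ioc (hΓ : IsGammaProcess Γ P) (a b : ℝ) :
    AEMeasurable (fun ω => pathMeasure (fun s => Γ s ω) (Ioc a b)) P := by
  refine ((hΓ.aemeasurable b.toNNReal).sub (hΓ.aemeasurable a.toNNReal)).ennreal_ofReal.congr ?_
  filter_upwards [hΓ.path] with ω hω
  exact (pathMeasure_Ioc hω a b).symm

/- On an exceptional null set the path measure need not depend measurably on `ω`, so measurability
is only available for the completed σ-algebra. -/
theorem IsGammaProcess.nullMeasurable_restrict_pathMeasure (hΓ : IsGammaProcess Γ P) (t : ℝ) :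
    NullMeasurable (fun ω => (pathMeasure fun s => Γ s ω).restrict (Ioc 0 t)) P := by
  have hfin (ω : NullMeasurableSpace Ω P) :
      IsFiniteMeasure ((pathMeasure fun s => Γ s ω).restrict (Ioc 0 t)) :=
    ⟨by rw [Measure.restrict_apply_univ]; exact measure_Ioc_lt_top⟩
  refine Measurable.measure_of_isPiSystem (α := NullMeasurableSpace Ω P)
    Real.borel_eq_generateFrom_Iic_rat Real.isPiSystem_Iic_rat ?_ ?_
  · intro s hs
    simp only [mem_iUnion, mem_singleton_iff] at hs
    obtain ⟨q, rfl⟩ := hs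
    simp_rw [Measure.restrict_apply measurableSet_Iic, inter_comm (Iic _), Ioc_inter_Iic]
    exact (hΓ.aemeasurable_pathMeasure_Ioc _ _).nullMeasurable
  · simp_rw [Measure.restrict_apply_univ]
    exact (hΓ.aemeasurable_pathMeasure_Ioc _ _).nullMeasurable

theorem measurable_comp_max_zero {f : ℝ → ℝ} (hf : MonotoneOn f (Ici 0) ∨ AntitoneOn f (Ici 0)) :
    Measurable fun x => f (max x 0) := by
  have hmax : Monotone fun x : ℝ => max x 0 := monotone_id.max monotone_const
  have hmem (x : ℝ) : max x 0 ∈ Ici (0 : ℝ) := le_max_right x 0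
  rcases hf with hf | hf
  · exact Monotone.measurable fun x y hxy => hf (hmem x) (hmem y) (hmax hxy)
  · exact Antitone.measurable fun x y hxy => hf (hmem x) (hmem y) (hmax hxy)

theorem IsGammaProcess.aemeasurable_gammaIntegral (hΓ : IsGammaProcess Γ P) {f : ℝ → ℝ}
    (hf0 : ∀ x, 0 ≤ x → 0 ≤ f x) (hf : MonotoneOn f (Ici 0) ∨ AntitoneOn f (Ici 0)) (t : ℝ) :
    AEMeasurable (gammaIntegral Γ f t) P := by
  have hfm := measurable_comp_max_zero hf
  have heq : gammaIntegral Γ f t = fun ω => (∫⁻ x, ENNReal.ofReal (f (max x 0))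
      ∂(pathMeasure fun s => Γ s ω).restrict (Ioc 0 t)).toReal := by
    ext ω
    rw [← integral_eq_lintegral_of_nonneg_ae (ae_of_all _ fun x => hf0 _ (le_max_right x 0))
      hfm.aestronglyMeasurable]
    refine setIntegral_congr_fun measurableSet_Ioc fun x hx => ?_
    simp only [max_eq_left hx.1.le]
  rw [heq]
  exact ((Measure.measurable_lintegral hfm.ennreal_ofReal).comp_nullMeasurable
    (hΓ.nullMeasurable_restrict_pathMeasure t)).aemeasurable.ennreal_toReal

theorem IsGammaProcess.aemeasurable_gammaRatio (hΓ : IsGammaProcess Γ P)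
    (hf0 : ∀ x, 0 ≤ x → 0 ≤ f x) (hf : MonotoneOn f (Ici 0) ∨ AntitoneOn f (Ici 0)) (t : ℝ) :
    AEMeasurable (gammaRatio Γ f t) P :=
  (hΓ.aemeasurable_gammaIntegral hf0 hf t).div_const _

end PathMeasure

section Laws

theorem lintegral_exp_mul_gammaMeasure {a θ : ℝ} (ha : 0 < a) (hθ : θ < 1) :
    ∫⁻ x, ENNReal.ofReal (Real.exp (θ * x)) ∂(gammaMeasure a 1) =
      ENNReal.ofReal ((1 - θ) ^ (-a)) := by
  have h1 : 0 < 1 - θ := by linarith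
  rw [gammaMeasure, lintegral_withDensity_eq_lintegral_mul _ (by unfold gammaPDF; fun_prop)
    (by fun_prop)]
  have : ∀ x, (gammaPDF a 1 * fun x => ENNReal.ofReal (Real.exp (θ * x))) x =
      ENNReal.ofReal ((1 - θ) ^ (-a)) * gammaPDF a (1 - θ) x := fun x => by
    rw [Pi.mul_apply]
    rcases lt_or_ge x 0 with hx | hx
    · simp [gammaPDF_of_neg hx]
    · rw [gammaPDF_of_nonneg hx, gammaPDF_of_nonneg hx, ← ENNReal.ofReal_mul
        (by have := Real.Gamma_pos_of_pos ha; positivity), ← ENNReal.ofReal_mul (by positivity)]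
      congr 1
      have : -((1 - θ) * x) = -(1 * x) + θ * x := by ring
      rw [this, Real.exp_add, Real.one_rpow, Real.rpow_neg h1.le]
      have := (Real.rpow_pos_of_pos h1 a).ne'
      field_simp
  simp_rw [this]
  rw [lintegral_const_mul _ (by unfold gammaPDF; fun_prop), lintegral_gammaPDF_eq_one ha h1,
    mul_one]

theorem integrable_exp_mul_gammaMeasure {a θ : ℝ} (ha : 0 < a) (hθ : θ < 1) :
    Integrable (fun x => Real.exp (θ * x)) (gammaMeasure a 1) := by
  refine ⟨by fun_prop, ?_⟩
  rw [hasFiniteIntegral_iff_ofReal (ae_of_all _ fun x => (Real.exp_pos _).le),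
    lintegral_exp_mul_gammaMeasure ha hθ]
  exact ENNReal.ofReal_lt_top

theorem mgf_gammaMeasure {a θ : ℝ} (ha : 0 < a) (hθ : θ < 1) :
    ∫ x, Real.exp (θ * x) ∂(gammaMeasure a 1) = (1 - θ) ^ (-a) := by
  rw [integral_eq_lintegral_of_nonneg_ae (ae_of_all _ fun x => (Real.exp_pos _).le) (by fun_prop),
    lintegral_exp_mul_gammaMeasure ha hθ, ENNReal.toReal_ofReal]
  exact Real.rpow_nonneg (by linarith) _

theorem memLp_id_expMeasure {p : ℝ≥0∞} (hp : p ≠ ∞) : MemLp id p (expMeasure 1) := by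
  lift p to ℝ≥0 using hp
  refine memLp_of_mem_interior_integrableExpSet ?_ p
  rw [mem_interior_iff_mem_nhds]
  filter_upwards [Iio_mem_nhds (zero_lt_one' ℝ)] with θ hθ
  exact integrable_exp_mul_gammaMeasure one_pos hθ

theorem expMeasure_Ioi_pos (x : ℝ) : 0 < (expMeasure 1) (Ioi x) := by
  have := isProbabilityMeasure_expMeasure one_pos
  rw [← compl_Iic, prob_compl_eq_one_sub measurableSet_Iic, tsub_pos_iff_lt]
  have h := cdf_expMeasure_eq one_pos x
  rw [cdf_eq_real, measureReal_def] at h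
  refine (ENNReal.toReal_lt_toReal (by finiteness) (by simp)).1 ?_
  rw [h, ENNReal.toReal_one]
  split_ifs
  · linarith [Real.exp_pos (-(1 * x))]
  · exact one_pos

theorem ae_nonneg_expMeasure : ∀ᵐ x ∂(expMeasure 1), (0 : ℝ) ≤ x := by
  have : {x : ℝ | ¬ 0 ≤ x} = Iio 0 := by ext x; simp
  rw [ae_iff, this, expMeasure, gammaMeasure, withDensity_apply _ measurableSet_Iio]
  exact lintegral_gammaPDF_of_nonpos le_rfl

variable {Ω Ω' : Type*} [MeasurableSpace Ω] [MeasurableSpace Ω'] {P : Measure Ω} {P' : Measure Ω'}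
  {Γ : ℝ≥0 → Ω → ℝ} {X : ℕ → Ω → ℝ} {Y : ℕ → Ω' → ℝ}

theorem IsIIDStdExponential.aemeasurable (hX : IsIIDStdExponential X P) (k : ℕ) :
    AEMeasurable (X (k + 1)) P :=
  (hX.law (k + 1) (by omega)).aemeasurable

theorem IsIIDStdExponential.memLp (hX : IsIIDStdExponential X P) (k : ℕ) {p : ℝ≥0∞} (hp : p ≠ ∞) :
    MemLp (X (k + 1)) p P := by
  have h := hX.law (k + 1) (by omega)
  have := memLp_id_expMeasure hp
  rw [← h.map_eq] at this
  exact (memLp_map_measure_iff aestronglyMeasurable_id h.aemeasurable).1 this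

theorem IsIIDStdExponential.ae_nonneg (hX : IsIIDStdExponential X P) :
    ∀ᵐ ω ∂P, ∀ k, 1 ≤ k → 0 ≤ X k ω := by
  refine ae_all_iff.2 fun k => ?_
  by_cases hk : 1 ≤ k
  · have h := hX.law k hk
    filter_upwards [(h.ae_iff (p := fun x => 0 ≤ x)
      (measurableSet_le measurable_const measurable_id).mem).2 ae_nonneg_expMeasure] with ω hω _
      using hω
  · exact ae_of_all _ fun _ h => absurd h hk

theorem IsIIDStdExponential.identDistrib (hX : IsIIDStdExponential X P)
    (hY : IsIIDStdExponential Y P') :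
    IdentDistrib (fun ω k => X (k + 1) ω) (fun ω k => Y (k + 1) ω) P P' where
  aemeasurable_fst := aemeasurable_pi_lambda _ hX.aemeasurable
  aemeasurable_snd := aemeasurable_pi_lambda _ hY.aemeasurable
  map_eq := by
    rw [hX.indep.map_fun_eq_infinitePi_map₀ (aemeasurable_pi_lambda _ hX.aemeasurable),
      hY.indep.map_fun_eq_infinitePi_map₀ (aemeasurable_pi_lambda _ hY.aemeasurable)]
    simp_rw [(hX.law _ (Nat.le_add_left 1 _)).map_eq, (hY.law _ (Nat.le_add_left 1 _)).map_eq]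

theorem IsIIDStdExponential.shift (hX : IsIIDStdExponential X P) :
    IsIIDStdExponential (fun k => X (k + 1)) P where
  indep := hX.indep.precomp (g := fun k => k + 1) (add_left_injective 1)
  law k _ := hX.law (k + 1) (by omega)

/-- The increment of the process over `(k - 1, k]`, which is standard exponential for `k ≥ 1`. At
`k = 0` the truncated subtraction makes it zero. -/
def unitIncrement {Ω : Type*} (Γ : ℝ≥0 → Ω → ℝ) (k : ℕ) (ω : Ω) : ℝ :=
  Γ k ω - Γ ((k - 1 : ℕ) : ℝ≥0) ω

theorem IsGammaProcess.isIIDStdExponential_unitIncrement (hΓ : IsGammaProcess Γ P) :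
    IsIIDStdExponential (unitIncrement Γ) P where
  indep := hΓ.indep.nat (t := fun k => (k : ℝ≥0)) Nat.mono_cast
  law k hk := by
    obtain ⟨k, rfl⟩ := Nat.exists_eq_add_of_le' hk
    have hlaw : HasLaw (unitIncrement Γ (k + 1)) (gammaMeasure ((k + 1 : ℕ) - k : ℝ) 1) P := by
      simpa only [NNReal.coe_natCast] using! hΓ.law k (k + 1 : ℕ) (by simp)
    simpa [expMeasure] using hlaw

theorem IsGammaProcess.integral_exp_neg_sum (hΓ : IsGammaProcess Γ P) {u : ℕ → ℝ≥0}
    (hu : StrictMono u) (n : ℕ) {c : ℕ → ℝ} (hc : ∀ i, 0 ≤ c i) :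
    ∫ ω, Real.exp (-∑ i ∈ Finset.range n, c i * (Γ (u (i + 1)) ω - Γ (u i) ω)) ∂P =
      Real.exp (-∑ i ∈ Finset.range n, Real.log (1 + c i) * (u (i + 1) - u i)) := by
  have hlaw (i : ℕ) := hΓ.law (u i) (u (i + 1)) (hu i.lt_succ_self)
  have hfactor (i : ℕ) : ∫ ω, Real.exp (-(c i * (Γ (u (i + 1)) ω - Γ (u i) ω))) ∂P =
      Real.exp (-(Real.log (1 + c i) * (u (i + 1) - u i))) := by
    have hpos : (0 : ℝ) < u (i + 1) - u i :=
      sub_pos.2 (NNReal.coe_lt_coe.2 (hu i.lt_succ_self))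
    have hmgf := (hlaw i).integral_comp (f := fun x => Real.exp (-c i * x)) (by fun_prop)
    rw [mgf_gammaMeasure hpos (by linarith [hc i]), sub_neg_eq_add,
      Real.rpow_def_of_pos (by linarith [hc i])] at hmgf
    simpa only [Function.comp_def, neg_mul, mul_neg] using hmgf
  have hindep : iIndepFun (fun (i : Fin n) ω => Γ (u (i + 1)) ω - Γ (u i) ω) P :=
    (hΓ.indep.nat hu.monotone).precomp Fin.val_injective
  have hprod := hindep.integral_fun_prod_comp (f := fun (i : Fin n) x => Real.exp (-(c i * x)))
    (fun i => (hlaw i).aemeasurable) (fun i => by fun_prop)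
  simp_rw [← Finset.sum_neg_distrib, Real.exp_sum, ← hfactor, Finset.prod_range]
  exact hprod

end Laws

section LaplaceTransform

variable {f : ℝ → ℝ}

theorem monotoneOn_or_antitoneOn_log_one_add (hf0 : ∀ x, 0 ≤ x → 0 ≤ f x)
    (hf : MonotoneOn f (Ici 0) ∨ AntitoneOn f (Ici 0)) :
    MonotoneOn (fun x => Real.log (1 + f x)) (Ici 0) ∨
      AntitoneOn (fun x => Real.log (1 + f x)) (Ici 0) := by
  have hlog {a b : ℝ} (ha : 0 ≤ a) (hab : a ≤ b) : Real.log (1 + a) ≤ Real.log (1 + b) :=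
    Real.log_le_log (by linarith) (by linarith)
  exact hf.imp (fun h x hx y hy hxy => hlog (hf0 x hx) (h hx hy hxy))
    (fun h x hx y hy hxy => hlog (hf0 y hy) (h hx hy hxy))

theorem le_max_of_monotoneOn_or_antitoneOn (hf : MonotoneOn f (Ici 0) ∨ AntitoneOn f (Ici 0))
    {a b x : ℝ} (ha : 0 ≤ a) (hx : x ∈ Icc a b) : f x ≤ max (f a) (f b) := by
  have hx0 : 0 ≤ x := ha.trans hx.1
  exact hf.elim (fun h => le_max_of_le_right (h hx0 (hx0.trans hx.2) hx.2))
    (fun h => le_max_of_le_left (h ha hx0 hx.1))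

theorem sum_abs_sub_of_monotone_or_antitone {a : ℕ → ℝ} (ha : Monotone a ∨ Antitone a) (n : ℕ) :
    ∑ i ∈ Finset.range n, |a (i + 1) - a i| = |a n - a 0| := by
  rcases ha with ha | ha
  · simp_rw [abs_of_nonneg (sub_nonneg.2 (ha (Nat.le_succ _))), Finset.sum_range_sub,
      abs_of_nonneg (sub_nonneg.2 (ha n.zero_le))]
  · simp_rw [abs_of_nonpos (sub_nonpos.2 (ha (Nat.le_succ _))), Finset.sum_neg_distrib,
      Finset.sum_range_sub, abs_of_nonpos (sub_nonpos.2 (ha n.zero_le))]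

theorem sum_max_mul_le_integral_add (hf : MonotoneOn f (Ici 0) ∨ AntitoneOn f (Ici 0)) {h : ℝ}
    (hh : 0 ≤ h) (n : ℕ) :
    ∑ i ∈ Finset.range n, max (f (i * h)) (f ((i + 1 : ℕ) * h)) * h ≤
      (∫ x in (0 : ℝ)..n * h, f x) + |f (n * h) - f 0| * h := by
  have hmono : Monotone fun i : ℕ => (i : ℝ) * h := Nat.mono_cast.mul_const hh
  have hmem (i : ℕ) : 0 ≤ (i : ℝ) * h := by positivity
  have hvol (i : ℕ) : volume.real (Ioc ((i : ℝ) * h) ((i + 1 : ℕ) * h)) = h := by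
    rw [Real.volume_real_Ioc_of_le (hmono i.le_succ)]
    push_cast
    ring
  have hneg : MonotoneOn (fun x => -f x) (Ici 0) ∨ AntitoneOn (fun x => -f x) (Ici 0) :=
    hf.symm.imp AntitoneOn.neg MonotoneOn.neg
  have hlower := intervalIntegral_le_sum_mul_measureReal_Ioc (μ := volume) hmono n
    (fun i => intervalIntegrable_of_monotoneOn_or_antitoneOn hneg (hmem i) (hmem (i + 1)))
    (fun i x hx => le_max_of_monotoneOn_or_antitoneOn hneg (hmem i) (Ioc_subset_Icc_self hx))
  simp only [hvol, max_neg_neg, intervalIntegral.integral_neg, neg_mul, Finset.sum_neg_distrib,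
    neg_le_neg_iff, Nat.cast_zero, zero_mul] at hlower
  have hosc := sum_abs_sub_of_monotone_or_antitone (a := fun i : ℕ => f (i * h))
    (hf.imp (fun H i j hij => H (hmem i) (hmem j) (hmono hij))
      (fun H i j hij => H (hmem i) (hmem j) (hmono hij))) n
  simp only [Nat.cast_zero, zero_mul] at hosc
  rw [← hosc, Finset.sum_mul]
  refine le_trans (le_of_eq ?_) (add_le_add_left hlower _)
  rw [← Finset.sum_add_distrib]
  refine Finset.sum_congr rfl fun i _ => ?_
  rw [← add_mul, ← max_sub_min_eq_abs', max_comm, min_comm]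
  ring

variable {Ω : Type*} [MeasurableSpace Ω] {P : Measure Ω} {Γ : ℝ≥0 → Ω → ℝ}

theorem integrable_exp_neg_of_nonneg [IsFiniteMeasure P] {Y : Ω → ℝ} (hY : AEMeasurable Y P)
    (hY0 : ∀ ω, 0 ≤ Y ω) : Integrable (fun ω => Real.exp (-Y ω)) P := by
  refine Integrable.of_bound (C := 1) hY.neg.exp.aestronglyMeasurable (ae_of_all _ fun ω => ?_)
  rw [Real.norm_eq_abs, Real.abs_exp, Real.exp_le_one_iff]
  exact neg_nonpos.2 (hY0 ω)

theorem IsGammaProcess.exp_neg_sum_log_le [IsFiniteMeasure P] (hΓ : IsGammaProcess Γ P)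
    (hf0 : ∀ x, 0 ≤ x → 0 ≤ f x) (hf : MonotoneOn f (Ici 0) ∨ AntitoneOn f (Ici 0)) {h : ℝ}
    (hh : 0 < h) (n : ℕ) :
    Real.exp (-∑ i ∈ Finset.range n,
        Real.log (1 + max (f (i * h)) (f ((i + 1 : ℕ) * h))) * h) ≤
      ∫ ω, Real.exp (-gammaIntegral Γ f (n * h) ω) ∂P := by
  lift h to ℝ≥0 using hh.le
  let u : ℕ → ℝ≥0 := fun i => i * h
  have hu : StrictMono u := Nat.strictMono_cast.mul_const (NNReal.coe_pos.1 hh)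
  have hmem (i : ℕ) : 0 ≤ (u i : ℝ) := (u i).2
  have hlaplace := hΓ.integral_exp_neg_sum hu n (c := fun i => max (f (u i)) (f (u (i + 1))))
    fun i => le_max_of_le_left (hf0 _ (hmem i))
  have hstep (i : ℕ) : (u (i + 1) - u i : ℝ) = h := by
    simp only [u]
    push_cast
    ring
  simp only [hstep] at hlaplace
  refine le_of_eq_of_le (hlaplace.trans (by simp [u])).symm (integral_mono_of_nonneg
    (ae_of_all _ fun ω => (Real.exp_pos _).le) (integrable_exp_neg_of_nonneg
      (hΓ.aemeasurable_gammaIntegral hf0 hf _) (gammaIntegral_nonneg Γ hf0 _)) ?_)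
  filter_upwards [hΓ.path] with ω hω
  refine Real.exp_le_exp.2 (neg_le_neg ?_)
  have hupper := intervalIntegral_le_sum_mul_measureReal_Ioc (u := fun i => (u i : ℝ))
    (μ := pathMeasure fun s => Γ s ω) (fun i j hij => hu.monotone hij) n
    (fun i => intervalIntegrable_of_monotoneOn_or_antitoneOn hf (hmem i) (hmem (i + 1)))
    (fun i x hx => le_max_of_monotoneOn_or_antitoneOn hf (hmem i) (Ioc_subset_Icc_self hx))
  simp only [pathMeasure_real_Ioc hω (hu.monotone (Nat.le_succ _))] at hupper
  rw [gammaIntegral_eq_intervalIntegral _ _ (by positivity)]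
  simpa [u] using hupper

theorem IsGammaProcess.exp_neg_integral_log_le [IsFiniteMeasure P] (hΓ : IsGammaProcess Γ P)
    (hf0 : ∀ x, 0 ≤ x → 0 ≤ f x) (hf : MonotoneOn f (Ici 0) ∨ AntitoneOn f (Ici 0)) {t : ℝ}
    (ht : 0 < t) :
    Real.exp (-∫ x in (0 : ℝ)..t, Real.log (1 + f x)) ≤
      ∫ ω, Real.exp (-gammaIntegral Γ f t ω) ∂P := by
  set I := ∫ x in (0 : ℝ)..t, Real.log (1 + f x)
  set osc := |Real.log (1 + f t) - Real.log (1 + f 0)|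
  have hgrid (n : ℕ) (hn : 0 < n) :
      Real.exp (-(I + osc * (t / n))) ≤ ∫ ω, Real.exp (-gammaIntegral Γ f t ω) ∂P := by
    have hh : 0 < t / n := by positivity
    have hnh : (n : ℝ) * (t / n) = t := by field_simp
    have hsum := sum_max_mul_le_integral_add (monotoneOn_or_antitoneOn_log_one_add hf0 hf) hh.le n
    have hexp := hΓ.exp_neg_sum_log_le hf0 hf hh n
    rw [hnh] at hsum hexp
    refine le_trans (Real.exp_le_exp.2 (neg_le_neg (le_trans (le_of_eq ?_) hsum))) hexp
    have hlog : MonotoneOn (fun x => Real.log (1 + x)) (Ici 0) := fun x (hx : 0 ≤ x) y _ hxy =>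
      Real.log_le_log (by linarith) (by linarith)
    refine Finset.sum_congr rfl fun i _ => ?_
    rw [← hlog.map_max (hf0 _ (by positivity)) (hf0 _ (by positivity))]
  have hlim : Tendsto (fun n : ℕ => Real.exp (-(I + osc * (t / n)))) atTop (𝓝 (Real.exp (-I))) := by
    have herr := (tendsto_const_div_atTop_nhds_zero_nat t).const_mul osc
    simpa using ((herr.const_add I).neg).rexp
  exact le_of_tendsto hlim (eventually_atTop.2 ⟨1, hgrid⟩)

end LaplaceTransform

section Concentration

theorem sub_log_one_add_tangent_le {x η : ℝ} (hx : 0 ≤ x) (hη : 0 ≤ η) :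
    η - Real.log (1 + η) + η / (1 + η) * (x - η) ≤ x - Real.log (1 + x) := by
  have hη1 : 0 < 1 + η := by linarith
  have hlog := Real.log_le_sub_one_of_pos (show 0 < (1 + x) / (1 + η) by positivity)
  rw [Real.log_div (by positivity) hη1.ne'] at hlog
  have hslope : (1 + x) / (1 + η) - 1 = (x - η) - η / (1 + η) * (x - η) := by
    field_simp
    ring
  linarith

theorem sub_log_one_add_integral_le {g : ℝ → ℝ} {a η : ℝ} (hg0 : ∀ x ∈ Icc a (a + 1), 0 ≤ g x)
    (hg : IntervalIntegrable g volume a (a + 1))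
    (hlog : IntervalIntegrable (fun x => Real.log (1 + g x)) volume a (a + 1)) (hη : 0 ≤ η)
    (hga : η ≤ ∫ x in a..a + 1, g x) :
    η - Real.log (1 + η) ≤ ∫ x in a..a + 1, (g x - Real.log (1 + g x)) := by
  have hdev : IntervalIntegrable (fun x => η / (1 + η) * (g x - η)) volume a (a + 1) :=
    (hg.sub intervalIntegrable_const).const_mul _
  calc η - Real.log (1 + η)
      ≤ η - Real.log (1 + η) + η / (1 + η) * ((∫ x in a..a + 1, g x) - η) :=
        le_add_of_nonneg_right (mul_nonneg (by positivity) (sub_nonneg.2 hga))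
    _ = ∫ x in a..a + 1, (η - Real.log (1 + η) + η / (1 + η) * (g x - η)) := by
        rw [intervalIntegral.integral_add intervalIntegrable_const hdev,
          intervalIntegral.integral_const_mul,
          intervalIntegral.integral_sub hg intervalIntegrable_const]
        simp
    _ ≤ ∫ x in a..a + 1, (g x - Real.log (1 + g x)) :=
        intervalIntegral.integral_mono_on (by linarith) (intervalIntegrable_const.add hdev)
          (hg.sub hlog) fun x hx => sub_log_one_add_tangent_le (hg0 x hx) hη

theorem integral_log_one_add_le_of_concentrated {g : ℝ → ℝ} (hg0 : ∀ x, 0 ≤ x → 0 ≤ g x)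
    (hg : MonotoneOn g (Ici 0) ∨ AntitoneOn g (Ici 0)) {a t η : ℝ} (ha : 0 ≤ a) (hat : a + 1 ≤ t)
    (hη : 0 ≤ η) (hga : η ≤ ∫ x in a..a + 1, g x) :
    ∫ x in (0 : ℝ)..t, Real.log (1 + g x) ≤
      (∫ x in (0 : ℝ)..t, g x) - (η - Real.log (1 + η)) := by
  have ht : 0 ≤ t := by linarith
  have ha1 : 0 ≤ a + 1 := by linarith
  have hint {b c : ℝ} (hb : 0 ≤ b) (hc : 0 ≤ c) : IntervalIntegrable g volume b c :=
    intervalIntegrable_of_monotoneOn_or_antitoneOn hg hb hc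
  have hintlog {b c : ℝ} (hb : 0 ≤ b) (hc : 0 ≤ c) :
      IntervalIntegrable (fun x => Real.log (1 + g x)) volume b c :=
    intervalIntegrable_of_monotoneOn_or_antitoneOn (monotoneOn_or_antitoneOn_log_one_add hg0 hg)
      hb hc
  have hlocal := sub_log_one_add_integral_le (fun x hx => hg0 x (ha.trans hx.1)) (hint ha ha1)
    (hintlog ha ha1) hη hga
  have hglobal : ∫ x in a..a + 1, (g x - Real.log (1 + g x)) ≤
      ∫ x in (0 : ℝ)..t, (g x - Real.log (1 + g x)) := by
    refine intervalIntegral.integral_mono_interval ha (by linarith) hat ?_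
      ((hint le_rfl ht).sub (hintlog le_rfl ht))
    filter_upwards [ae_restrict_mem measurableSet_Ioc] with x hx
    have := hg0 x hx.1.le
    have := Real.log_le_sub_one_of_pos (show 0 < 1 + g x by linarith)
    simp only [Pi.zero_apply]
    linarith
  rw [intervalIntegral.integral_sub (hint le_rfl ht) (hintlog le_rfl ht)] at hglobal
  linarith

variable {Ω : Type*} [MeasurableSpace Ω] {P : Measure Ω} [IsProbabilityMeasure P]

theorem tendsto_integral_exp_neg_of_tendstoInMeasure {ι : Type*} {l : Filter ι}
    [l.IsCountablyGenerated] {R : ι → Ω → ℝ} {c : ℝ} (hR : TendstoInMeasure P R l fun _ => c)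
    (mR : ∀ i, AEMeasurable (R i) P) (hR0 : ∀ i ω, 0 ≤ R i ω) (hc : 0 ≤ c) :
    Tendsto (fun i => ∫ ω, Real.exp (-R i ω) ∂P) l (𝓝 (Real.exp (-c))) := by
  let φ : BoundedContinuousFunction ℝ ℝ :=
    .ofNormedAddCommGroup (fun x => Real.exp (-|x|)) (by fun_prop) 1 (by simp)
  have hφ := ProbabilityMeasure.tendsto_iff_forall_integral_tendsto.1
    (hR.tendstoInDistribution_of_aemeasurable mR aemeasurable_const).tendsto φ
  have hmap (Y : Ω → ℝ) (mY : AEMeasurable Y P) :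
      ∫ x, φ x ∂P.map Y = ∫ ω, Real.exp (-|Y ω|) ∂P :=
    integral_map mY φ.continuous.aestronglyMeasurable
  simp only [ProbabilityMeasure.coe_mk, hmap _ (mR _), hmap _ aemeasurable_const, integral_const,
    probReal_univ, one_smul, abs_of_nonneg hc, abs_of_nonneg (hR0 _ _)] at hφ
  exact hφ

variable {Γ : ℝ≥0 → Ω → ℝ} {f : ℝ → ℝ}

theorem gammaRatio_eq_gammaIntegral_div {Ω : Type*} (Γ : ℝ≥0 → Ω → ℝ) (f : ℝ → ℝ) (t : ℝ) :
    gammaRatio Γ f t = gammaIntegral Γ (fun x => f x / ∫ y in (0 : ℝ)..t, f y) t :=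
  funext fun _ => (integral_div _ _).symm

theorem IsGammaProcess.exp_neg_le_integral_exp_neg_gammaRatio (hΓ : IsGammaProcess Γ P)
    (hf0 : ∀ x, 0 ≤ x → 0 ≤ f x) (hf : MonotoneOn f (Ici 0) ∨ AntitoneOn f (Ici 0))
    {a t η : ℝ} (ha : 0 ≤ a) (hat : a + 1 ≤ t) (hη : 0 ≤ η) (hη1 : η ≤ 1)
    (hfa : η * ∫ x in (0 : ℝ)..t, f x ≤ ∫ x in a..a + 1, f x) :
    Real.exp (-(1 - (η - Real.log (1 + η)))) ≤ ∫ ω, Real.exp (-gammaRatio Γ f t ω) ∂P := by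
  set Λ := ∫ x in (0 : ℝ)..t, f x with hΛ
  have hΛ0 : 0 ≤ Λ :=
    intervalIntegral.integral_nonneg (by linarith) fun x hx => hf0 x hx.1
  have hg0 (x : ℝ) (hx : 0 ≤ x) : 0 ≤ f x / Λ := div_nonneg (hf0 x hx) hΛ0
  have hg : MonotoneOn (fun x => f x / Λ) (Ici 0) ∨ AntitoneOn (fun x => f x / Λ) (Ici 0) :=
    hf.imp (fun h x hx y hy hxy => div_le_div_of_nonneg_right (h hx hy hxy) hΛ0)
      (fun h x hx y hy hxy => div_le_div_of_nonneg_right (h hx hy hxy) hΛ0)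
  have hlog : ∫ x in (0 : ℝ)..t, Real.log (1 + f x / Λ) ≤ 1 - (η - Real.log (1 + η)) := by
    rcases hΛ0.eq_or_lt with hzero | hpos
    · have := Real.log_nonneg (show 1 ≤ 1 + η by linarith)
      simp only [← hzero, div_zero, add_zero, Real.log_one, intervalIntegral.integral_zero]
      linarith
    · have hconc := integral_log_one_add_le_of_concentrated hg0 hg ha hat hη
        (by rwa [intervalIntegral.integral_div, le_div_iff₀ hpos])
      rwa [intervalIntegral.integral_div, ← hΛ, div_self hpos.ne'] at hconc
  rw [gammaRatio_eq_gammaIntegral_div]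
  exact (Real.exp_le_exp.2 (neg_le_neg hlog)).trans
    (hΓ.exp_neg_integral_log_le hg0 hg (by linarith))

theorem IsGammaProcess.not_tendstoInMeasure_gammaRatio (hΓ : IsGammaProcess Γ P)
    (hf0 : ∀ x, 0 ≤ x → 0 ≤ f x) (hf : MonotoneOn f (Ici 0) ∨ AntitoneOn f (Ici 0)) {η : ℝ}
    (hη : 0 < η) (hη1 : η ≤ 1)
    (hfreq : ∃ᶠ t in atTop, ∃ a, 0 ≤ a ∧ a + 1 ≤ t ∧
      η * ∫ x in (0 : ℝ)..t, f x ≤ ∫ x in a..a + 1, f x) :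
    ¬ TendstoInMeasure P (gammaRatio Γ f) atTop fun _ => 1 := by
  intro h
  have hlim := tendsto_integral_exp_neg_of_tendstoInMeasure h
    (hΓ.aemeasurable_gammaRatio hf0 hf) (gammaRatio_nonneg Γ hf0) zero_le_one
  have hgap : Real.log (1 + η) < η := by
    linarith [Real.log_lt_sub_one_of_pos (show 0 < 1 + η by linarith) (by linarith)]
  have hlt : ∀ᶠ t in atTop, ∫ ω, Real.exp (-gammaRatio Γ f t ω) ∂P <
      Real.exp (-(1 - (η - Real.log (1 + η)))) :=
    hlim.eventually_lt_const (Real.exp_lt_exp.2 (by linarith))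
  obtain ⟨t, ⟨a, ha, hat, hfa⟩, hlt⟩ := (hfreq.and_eventually hlt).exists
  exact hlt.not_ge (hΓ.exp_neg_le_integral_exp_neg_gammaRatio hf0 hf ha hat hη.le hη1 hfa)

end Concentration

section Weights

/-- `W_n = w_1 + ⋯ + w_n`, the denominator of `weightedRatio w X n`. -/
def weightSum (w : ℕ → ℝ) (n : ℕ) : ℝ :=
  ∑ k ∈ Finset.Icc 1 n, w k

/-- Each of the weights `w_1, …, w_n` is an asymptotically vanishing proportion of `W_n`, uniformly
in the index. The inequality is strict so that nonnegative negligible weights have `0 < W_n` for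
large `n`. -/
def NegligibleWeights (w : ℕ → ℝ) : Prop :=
  ∀ δ, 0 < δ → ∀ᶠ n in atTop, ∀ k ∈ Finset.Icc 1 n, w k < δ * weightSum w n

variable {w : ℕ → ℝ} {f : ℝ → ℝ}

theorem weightSum_nonneg (hw : ∀ k, 0 ≤ w k) (n : ℕ) : 0 ≤ weightSum w n :=
  Finset.sum_nonneg fun k _ => hw k

theorem sum_Icc_one_eq_sum_range (a : ℕ → ℝ) (n : ℕ) :
    ∑ k ∈ Finset.Icc 1 n, a k = ∑ i ∈ Finset.range n, a (i + 1) := by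
  rw [Finset.range_eq_Ico, Finset.sum_Ico_add' a 0 n 1]
  rfl

/-- `S_n = w_1 X_1 + ⋯ + w_n X_n`, the numerator of `weightedRatio w X n`. -/
def weightedSum {Ω : Type*} (w : ℕ → ℝ) (X : ℕ → Ω → ℝ) (n : ℕ) (ω : Ω) : ℝ :=
  ∑ k ∈ Finset.Icc 1 n, w k * X k ω

theorem weightedRatio_eq_div {Ω : Type*} (w : ℕ → ℝ) (X : ℕ → Ω → ℝ) (n : ℕ) (ω : Ω) :
    weightedRatio w X n ω = weightedSum w X n ω / weightSum w n :=
  rfl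

namespace NegligibleWeights

theorem eventually_weightSum_pos (h : NegligibleWeights w) (hw : ∀ k, 0 ≤ w k) :
    ∀ᶠ n in atTop, 0 < weightSum w n := by
  filter_upwards [h 1 one_pos, eventually_ge_atTop 1] with n hn hn1
  simpa using (hw n).trans_lt (hn n (Finset.right_mem_Icc.2 hn1))

theorem tendsto_weightSum (h : NegligibleWeights w) (hw : ∀ k, 0 ≤ w k) :
    Tendsto (weightSum w) atTop atTop := by
  obtain ⟨n, hn⟩ := (h.eventually_weightSum_pos hw).exists
  obtain ⟨k, hk, hwk⟩ := Finset.exists_lt_of_sum_lt (s := Finset.Icc 1 n)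
    (f := fun _ => (0 : ℝ)) (g := w) (by simpa [weightSum] using hn)
  refine tendsto_atTop.2 fun C => ?_
  have hC : 0 < |C| + 1 := by positivity
  filter_upwards [h (w k / (|C| + 1)) (by positivity), eventually_ge_atTop k] with N hN hkN
  have hlt := hN k (Finset.mem_Icc.2 ⟨(Finset.mem_Icc.1 hk).1, hkN⟩)
  rw [div_mul_eq_mul_div, lt_div_iff₀ hC, mul_lt_mul_iff_right₀ hwk] at hlt
  linarith [le_abs_self C]

theorem isLittleO_weightSum (h : NegligibleWeights w) (hw : ∀ k, 0 ≤ w k) :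
    w =o[atTop] weightSum w := by
  refine isLittleO_iff.2 fun δ hδ => ?_
  filter_upwards [h δ hδ, eventually_ge_atTop 1] with n hn hn1
  rw [Real.norm_of_nonneg (hw n), Real.norm_of_nonneg (weightSum_nonneg hw n)]
  exact (hn n (Finset.right_mem_Icc.2 hn1)).le

theorem isEquivalent_weightSum_succ (h : NegligibleWeights w) (hw : ∀ k, 0 ≤ w k) :
    (fun n => weightSum w (n + 1)) ~[atTop] weightSum w := by
  refine IsEquivalent.symm ?_
  have hlast := ((h.isLittleO_weightSum hw).comp_tendsto (tendsto_add_atTop_nat 1)).neg_left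
  refine hlast.congr_left fun n => ?_
  simp [weightSum, Finset.sum_Icc_succ_top]

end NegligibleWeights

theorem volume_real_Ioc_natCast_succ (i : ℕ) : volume.real (Ioc (i : ℝ) (i + 1 : ℕ)) = 1 := by
  simp

theorem weightSum_eq_sum_mul_volume_real (f : ℝ → ℝ) (n : ℕ) :
    weightSum (fun k => f k) n =
      ∑ i ∈ Finset.range n, f (i + 1 : ℕ) * volume.real (Ioc (i : ℝ) (i + 1 : ℕ)) := by
  simp_rw [weightSum, sum_Icc_one_eq_sum_range fun k => f k, volume_real_Ioc_natCast_succ, mul_one]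

theorem abs_integral_sub_weightSum_le (hf : MonotoneOn f (Ici 0) ∨ AntitoneOn f (Ici 0)) (n : ℕ) :
    |(∫ x in (0 : ℝ)..n, f x) - weightSum (fun k => f k) n| ≤ |f n - f 0| := by
  have htele : ∑ i ∈ Finset.range n, f i * volume.real (Ioc (i : ℝ) (i + 1 : ℕ)) =
      weightSum (fun k => f k) n - (f n - f 0) := by
    have hsub := Finset.sum_range_sub (fun i : ℕ => f i) n
    rw [Finset.sum_sub_distrib] at hsub
    simp_rw [weightSum, sum_Icc_one_eq_sum_range fun k => f k, volume_real_Ioc_natCast_succ,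
      mul_one]
    rw [Nat.cast_zero] at hsub
    linarith
  rcases hf with hf | hf
  · have hupper := integral_le_sum_of_monotoneOn (μ := volume) hf n
    have hlower := sum_le_integral_of_monotoneOn (μ := volume) hf n
    rw [← weightSum_eq_sum_mul_volume_real] at hupper
    rw [htele] at hlower
    rw [abs_of_nonpos (by linarith)]
    linarith [le_abs_self (f n - f 0)]
  · have hupper := integral_le_sum_of_antitoneOn (μ := volume) hf n
    have hlower := sum_le_integral_of_antitoneOn (μ := volume) hf n
    rw [← weightSum_eq_sum_mul_volume_real] at hlower
    rw [htele] at hupper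
    rw [abs_of_nonneg (by linarith)]
    linarith [neg_abs_le (f n - f 0)]

theorem NegligibleWeights.isEquivalent_integral (h : NegligibleWeights fun k => f k)
    (hf0 : ∀ x, 0 ≤ x → 0 ≤ f x) (hf : MonotoneOn f (Ici 0) ∨ AntitoneOn f (Ici 0)) :
    (fun n : ℕ => ∫ x in (0 : ℝ)..n, f x) ~[atTop] weightSum fun k => f k := by
  have hw (k : ℕ) : 0 ≤ f k := hf0 k k.cast_nonneg
  have hconst : (fun _ : ℕ => f 0) =o[atTop] weightSum fun k => f k :=
    isLittleO_const_left.2 (.inr (tendsto_norm_atTop_atTop.comp (h.tendsto_weightSum hw)))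
  have hosc : (fun n : ℕ => f n - f 0) =o[atTop] weightSum fun k => f k :=
    (h.isLittleO_weightSum hw).sub hconst
  exact (isBigO_of_le _ (abs_integral_sub_weightSum_le hf)).trans_isLittleO hosc

theorem integral_le_weightSum_of_monotoneOn (hf : MonotoneOn f (Ici 0)) (n : ℕ) :
    ∫ x in (0 : ℝ)..n, f x ≤ weightSum (fun k => f k) n := by
  rw [weightSum_eq_sum_mul_volume_real]
  exact integral_le_sum_of_monotoneOn hf n

theorem integral_from_one_le_weightSum_of_antitoneOn (hf : AntitoneOn f (Ici 0)) (n : ℕ) :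
    ∫ x in (1 : ℝ)..n + 1, f x ≤ weightSum (fun k => f k) n := by
  have hshift : AntitoneOn (fun x => f (x + 1)) (Ici 0) :=
    fun x (hx : 0 ≤ x) y (hy : 0 ≤ y) hxy =>
      hf (show 0 ≤ x + 1 by positivity) (show 0 ≤ y + 1 by positivity) (by linarith)
  have h := integral_le_sum_of_antitoneOn (μ := volume) hshift n
  rw [intervalIntegral.integral_comp_add_right, zero_add] at h
  simpa [weightSum_eq_sum_mul_volume_real] using h

theorem mul_integral_le_integral_of_monotoneOn (hf : MonotoneOn f (Ici 0)) {δ : ℝ} (hδ : 0 < δ)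
    {k n : ℕ} (hk : k ∈ Finset.Icc 1 n) (hδk : δ * weightSum (fun k => f k) n ≤ f k) :
    δ / (1 + δ) * ∫ x in (0 : ℝ)..n + 1, f x ≤ ∫ x in (n : ℝ)..n + 1, f x := by
  have hn : (0 : ℝ) ≤ n := n.cast_nonneg
  have hint {a b : ℝ} (ha : 0 ≤ a) (hb : 0 ≤ b) : IntervalIntegrable f volume a b :=
    intervalIntegrable_of_monotoneOn_or_antitoneOn (.inl hf) ha hb
  have hlast : f k ≤ ∫ x in (n : ℝ)..n + 1, f x := by
    have h := intervalIntegral.integral_mono_on (le_add_of_nonneg_right zero_le_one)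
      intervalIntegrable_const (hint hn (by positivity)) fun x hx =>
        hf (mem_Ici.2 k.cast_nonneg) (mem_Ici.2 (hn.trans hx.1))
          ((Nat.cast_le.2 (Finset.mem_Icc.1 hk).2).trans hx.1)
    simpa using h
  have hrest := mul_le_mul_of_nonneg_left (integral_le_weightSum_of_monotoneOn hf n) hδ.le
  rw [← intervalIntegral.integral_add_adjacent_intervals (hint le_rfl hn)
    (hint hn (by positivity)), div_mul_eq_mul_div, div_le_iff₀ (by positivity)]
  linarith

theorem mul_integral_le_integral_of_antitoneOn (hf : AntitoneOn f (Ici 0)) {δ : ℝ} (hδ : 0 < δ)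
    {k n : ℕ} (hk : k ∈ Finset.Icc 1 n) (hδk : δ * weightSum (fun k => f k) n ≤ f k) :
    δ / (1 + δ) * ∫ x in (0 : ℝ)..n + 1, f x ≤ ∫ x in (0 : ℝ)..1, f x := by
  have hint {a b : ℝ} (ha : 0 ≤ a) (hb : 0 ≤ b) : IntervalIntegrable f volume a b :=
    intervalIntegrable_of_monotoneOn_or_antitoneOn (.inr hf) ha hb
  have hfirst : f k ≤ ∫ x in (0 : ℝ)..1, f x := by
    have h := intervalIntegral.integral_mono_on zero_le_one intervalIntegrable_const
      (hint le_rfl zero_le_one) fun x hx => hf hx.1 (mem_Ici.2 k.cast_nonneg)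
        (hx.2.trans (Nat.one_le_cast.2 (Finset.mem_Icc.1 hk).1))
    simpa using h
  have hrest := mul_le_mul_of_nonneg_left (integral_from_one_le_weightSum_of_antitoneOn hf n) hδ.le
  rw [← intervalIntegral.integral_add_adjacent_intervals (hint le_rfl zero_le_one)
    (hint zero_le_one (by positivity)), div_mul_eq_mul_div, div_le_iff₀ (by positivity)]
  linarith

end Weights

section NonNegligible

theorem one_le_weightedRatio_sub_one {Ω : Type*} {w : ℕ → ℝ} (hw : ∀ k, 0 ≤ w k) {X : ℕ → Ω → ℝ}
    {ω : Ω} (hX : ∀ k, 1 ≤ k → 0 ≤ X k ω) {n k : ℕ} (hk : k ∈ Finset.Icc 1 n) {δ : ℝ} (hδ : 0 < δ)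
    (hW : 0 < weightSum w n) (hδk : δ * weightSum w n ≤ w k) (hXk : 2 / δ < X k ω) :
    1 ≤ weightedRatio w X n ω - 1 := by
  have hterm : w k * X k ω ≤ weightedSum w X n ω :=
    Finset.single_le_sum (f := fun k => w k * X k ω)
      (fun i hi => mul_nonneg (hw i) (hX i (Finset.mem_Icc.1 hi).1)) hk
  have hratio : 2 ≤ weightedRatio w X n ω := by
    refine (le_div_iff₀ hW).2 (le_trans ?_ hterm)
    calc 2 * weightSum w n = δ * weightSum w n * (2 / δ) := by field_simp
      _ ≤ w k * X k ω := mul_le_mul hδk hXk.le (by positivity) (hw k)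
  linarith

variable {Ω : Type*} [MeasurableSpace Ω] {P : Measure Ω}

theorem IsGammaProcess.not_tendstoZero_gammaRatio_sub_one [IsProbabilityMeasure P]
    {Γ : ℝ≥0 → Ω → ℝ} (hΓ : IsGammaProcess Γ P) {f : ℝ → ℝ} (hf0 : ∀ x, 0 ≤ x → 0 ≤ f x)
    (hf : MonotoneOn f (Ici 0) ∨ AntitoneOn f (Ici 0)) (hW : ¬ NegligibleWeights fun k => f k) :
    ¬ ConvMode.inMeasure.TendstoZero P atTop (fun t ω => gammaRatio Γ f t ω - 1) := by
  simp only [NegligibleWeights, not_forall, not_eventually, not_lt, exists_prop] at hW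
  obtain ⟨δ, hδ, hfreq⟩ := hW
  have hη1 : δ / (1 + δ) ≤ 1 := (div_le_one (by positivity)).2 (by linarith)
  have hnat : Tendsto (fun n : ℕ => (n : ℝ) + 1) atTop atTop :=
    tendsto_atTop_add_const_right _ _ tendsto_natCast_atTop_atTop
  have hnot := hΓ.not_tendstoInMeasure_gammaRatio hf0 hf (by positivity) hη1
    (hnat.frequently (hfreq.mono fun n ⟨k, hk, hδk⟩ => hf.elim
      (fun hf => ⟨n, n.cast_nonneg, le_rfl, mul_integral_le_integral_of_monotoneOn hf hδ hk hδk⟩)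
      (fun hf => ⟨0, le_rfl, by simp, by
        simpa using mul_integral_le_integral_of_antitoneOn hf hδ hk hδk⟩)))
  simpa [ConvMode.tendstoZero_inMeasure_iff, tendstoInMeasure_iff_norm] using hnot

theorem IsIIDStdExponential.not_tendstoZero_weightedRatio_sub_one
    {X : ℕ → Ω → ℝ} (hX : IsIIDStdExponential X P) {w : ℕ → ℝ} (hw : ∀ k, 0 ≤ w k)
    (hW : ¬ NegligibleWeights w) :
    ¬ ConvMode.inMeasure.TendstoZero P atTop (fun n ω => weightedRatio w X n ω - 1) := by
  intro hnull
  simp only [NegligibleWeights, not_forall, not_eventually, not_lt, exists_prop] at hW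
  obtain ⟨δ, hδ, hfreq⟩ := hW
  obtain ⟨n, ⟨k, hk, hδk⟩, hsmall⟩ := (hfreq.and_eventually
    ((ConvMode.tendstoZero_inMeasure_iff.1 hnull 1 one_pos).eventually_lt_const
      (expMeasure_Ioi_pos (2 / δ)))).exists
  have hlaw := hX.law k (Finset.mem_Icc.1 hk).1
  refine hsmall.not_ge ?_
  rw [← hlaw.map_eq, Measure.map_apply_of_aemeasurable hlaw.aemeasurable measurableSet_Ioi]
  refine measure_mono_ae ?_
  filter_upwards [hX.ae_nonneg] with ω hω
  intro (hXk : 2 / δ < X k ω)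
  change 1 ≤ |weightedRatio w X n ω - 1|
  rcases (weightSum_nonneg hw n).eq_or_lt with hzero | hpos
  · have hratio : weightedRatio w X n ω = 0 := by
      rw [weightedRatio_eq_div, ← hzero, div_zero]
    simp [hratio]
  · exact (one_le_weightedRatio_sub_one hw hω hk hδ hpos hδk hXk).trans (le_abs_self _)

end NonNegligible

section Comparison

variable {Ω Ω' : Type*} [MeasurableSpace Ω] [MeasurableSpace Ω'] {P : Measure Ω} {P' : Measure Ω'}
  {w : ℕ → ℝ} {X : ℕ → Ω → ℝ} {Y : ℕ → Ω' → ℝ} {Γ : ℝ≥0 → Ω → ℝ} {f : ℝ → ℝ} {m : ConvMode}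

theorem weightedRatio_eq_sum_range {Ω : Type*} (w : ℕ → ℝ) (X : ℕ → Ω → ℝ) (n : ℕ) (ω : Ω) :
    weightedRatio w X n ω =
      (∑ i ∈ Finset.range n, w (i + 1) * X (i + 1) ω) / weightSum w n := by
  rw [weightedRatio_eq_div, weightedSum, sum_Icc_one_eq_sum_range fun k => w k * X k ω]

theorem IsIIDStdExponential.aemeasurable_weightedSum (hX : IsIIDStdExponential X P) (w : ℕ → ℝ)
    (n : ℕ) : AEMeasurable (weightedSum w X n) P :=
  Finset.aemeasurable_fun_sum _ fun k hk =>
    (hX.law k (Finset.mem_Icc.1 hk).1).aemeasurable.const_mul _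

theorem IsIIDStdExponential.tendstoZero_weightedRatio_sub_one (hX : IsIIDStdExponential X P)
    (hY : IsIIDStdExponential Y P')
    (h : m.TendstoZero P atTop (fun n ω => weightedRatio w X n ω - 1)) :
    m.TendstoZero P' atTop (fun n ω => weightedRatio w Y n ω - 1) := by
  simp only [weightedRatio_eq_sum_range] at h ⊢
  exact ConvMode.TendstoZero.of_identDistrib (hX.identDistrib hY)
    (g := fun n x => (∑ i ∈ Finset.range n, w (i + 1) * x i) / weightSum w n - 1)
    (fun n => by fun_prop) h

theorem IsIIDStdExponential.tendstoZero_weightedRatio_sub_one_of_le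
    {X' : ℕ → Ω → ℝ} (hX : IsIIDStdExponential X P) (hX' : IsIIDStdExponential X' P)
    {L U : ℕ → Ω → ℝ} (hL : m.TendstoZero P atTop L) (hU : m.TendstoZero P atTop U)
    (hLX : ∀ᵐ ω ∂P, ∀ n, L n ω ≤ weightedRatio w X n ω - 1)
    (hXU : ∀ᵐ ω ∂P, ∀ n, weightedRatio w X' n ω - 1 ≤ U n ω) :
    m.TendstoZero P atTop (fun n ω => weightedRatio w X n ω - 1) := by
  simp only [weightedRatio_eq_sum_range] at hLX hXU ⊢
  exact ConvMode.TendstoZero.squeeze_identDistrib (hX.identDistrib hX')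
    (g := fun n x => (∑ i ∈ Finset.range n, w (i + 1) * x i) / weightSum w n - 1)
    (fun n => by fun_prop) hL hU hLX hXU

theorem NegligibleWeights.tendstoZero_div_sub_one_iff_succ [IsFiniteMeasure P]
    (hW : NegligibleWeights w) (hw : ∀ k, 0 ≤ w k) {F : ℕ → Ω → ℝ}
    (mF : ∀ n, AEMeasurable (F n) P) {ξ : Ω → ℝ} (hξ : ∀ p : ℝ≥0∞, p ≠ ∞ → MemLp ξ p P) :
    m.TendstoZero P atTop (fun n ω => F n ω / weightSum w n - 1) ↔
      m.TendstoZero P atTop (fun n ω => (F (n + 1) ω - ξ ω) / weightSum w n - 1) := by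
  have hsucc := hW.isEquivalent_weightSum_succ hw
  have mξ : AEMeasurable ξ P := (hξ 0 (by simp)).1.aemeasurable
  have hξ0 : m.TendstoZero P atTop (fun n ω => (weightSum w n)⁻¹ * ξ ω) :=
    ConvMode.tendstoZero_mul_memLp (hW.tendsto_weightSum hw).inv_tendsto_atTop hξ
  constructor <;> intro h
  · have hF := (h.comp (tendsto_add_atTop_nat 1)).div_sub_one_of_isEquivalent hsucc
      fun n => mF (n + 1)
    refine (hF.add (hξ0.const_mul (-1)) (fun n => ((mF _).div_const _).sub_const 1)
      (fun n => (mξ.const_mul _).const_mul _)).congr univ_mem (ae_of_all _ fun ω n _ => ?_)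
    ring
  · have hF : m.TendstoZero P atTop (fun n ω => F (n + 1) ω / weightSum w n - 1) := by
      refine (h.add hξ0 (fun n => (((mF _).sub mξ).div_const _).sub_const 1)
        (fun n => mξ.const_mul _)).congr univ_mem (ae_of_all _ fun ω n _ => ?_)
      ring
    refine ((hF.div_sub_one_of_isEquivalent hsucc.symm fun n => mF (n + 1)).comp
      (tendsto_sub_atTop_nat 1)).congr (Ici_mem_atTop 1) (ae_of_all _ fun ω n hn => ?_)
    rw [Nat.sub_add_cancel hn]

theorem pathMeasure_real_Ioc_natCast_succ {Ω : Type*} {Γ : ℝ≥0 → Ω → ℝ} {ω : Ω}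
    (hω : IsIncreasingRightContinuous fun t => Γ t ω) (i : ℕ) :
    (pathMeasure fun t => Γ t ω).real (Ioc (i : ℝ) (i + 1 : ℕ)) = unitIncrement Γ (i + 1) ω :=
  pathMeasure_real_Ioc hω (Nat.cast_le.2 i.le_succ)

theorem sum_right_mul_pathMeasure_real {Ω : Type*} {Γ : ℝ≥0 → Ω → ℝ} {ω : Ω}
    (hω : IsIncreasingRightContinuous fun t => Γ t ω) (f : ℝ → ℝ) (n : ℕ) :
    ∑ i ∈ Finset.range n, f (i + 1 : ℕ) * (pathMeasure fun t => Γ t ω).real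
      (Ioc (i : ℝ) (i + 1 : ℕ)) = weightedSum (fun k => f k) (unitIncrement Γ) n ω := by
  simp_rw [pathMeasure_real_Ioc_natCast_succ hω, weightedSum,
    sum_Icc_one_eq_sum_range fun k => f k * unitIncrement Γ k ω]

theorem sum_left_mul_pathMeasure_real {Ω : Type*} {Γ : ℝ≥0 → Ω → ℝ} {ω : Ω}
    (hω : IsIncreasingRightContinuous fun t => Γ t ω) (f : ℝ → ℝ) (n : ℕ) :
    ∑ i ∈ Finset.range (n + 1), f i * (pathMeasure fun t => Γ t ω).real
      (Ioc (i : ℝ) (i + 1 : ℕ)) =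
        weightedSum (fun k => f k) (fun k => unitIncrement Γ (k + 1)) n ω +
          f 0 * unitIncrement Γ 1 ω := by
  simp_rw [pathMeasure_real_Ioc_natCast_succ hω, weightedSum,
    sum_Icc_one_eq_sum_range fun k => f k * unitIncrement Γ (k + 1) ω, Finset.sum_range_succ',
    Nat.cast_zero]

theorem gammaIntegral_sandwich_of_monotoneOn {Ω : Type*} {Γ : ℝ≥0 → Ω → ℝ} {ω : Ω}
    (hω : IsIncreasingRightContinuous fun t => Γ t ω) (hf : MonotoneOn f (Ici 0)) (n : ℕ) :
    gammaIntegral Γ f n ω ≤ weightedSum (fun k => f k) (unitIncrement Γ) n ω ∧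
      weightedSum (fun k => f k) (fun k => unitIncrement Γ (k + 1)) n ω ≤
        gammaIntegral Γ f (n + 1 : ℕ) ω - f 0 * unitIncrement Γ 1 ω := by
  rw [le_sub_iff_add_le, ← sum_left_mul_pathMeasure_real hω, ← sum_right_mul_pathMeasure_real hω,
    gammaIntegral_eq_intervalIntegral _ _ (Nat.cast_nonneg _),
    gammaIntegral_eq_intervalIntegral _ _ (Nat.cast_nonneg _)]
  exact ⟨integral_le_sum_of_monotoneOn hf n, sum_le_integral_of_monotoneOn hf (n + 1)⟩

theorem gammaIntegral_sandwich_of_antitoneOn {Ω : Type*} {Γ : ℝ≥0 → Ω → ℝ} {ω : Ω}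
    (hω : IsIncreasingRightContinuous fun t => Γ t ω) (hf : AntitoneOn f (Ici 0)) (n : ℕ) :
    weightedSum (fun k => f k) (unitIncrement Γ) n ω ≤ gammaIntegral Γ f n ω ∧
      gammaIntegral Γ f (n + 1 : ℕ) ω - f 0 * unitIncrement Γ 1 ω ≤
        weightedSum (fun k => f k) (fun k => unitIncrement Γ (k + 1)) n ω := by
  rw [sub_le_iff_le_add, ← sum_left_mul_pathMeasure_real hω, ← sum_right_mul_pathMeasure_real hω,
    gammaIntegral_eq_intervalIntegral _ _ (Nat.cast_nonneg _),
    gammaIntegral_eq_intervalIntegral _ _ (Nat.cast_nonneg _)]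
  exact ⟨sum_le_integral_of_antitoneOn hf n, integral_le_sum_of_antitoneOn hf (n + 1)⟩

theorem NegligibleWeights.tendstoZero_gammaRatio_sub_one_iff_natCast [IsFiniteMeasure P]
    (hW : NegligibleWeights fun k => f k) (hΓ : IsGammaProcess Γ P)
    (hf0 : ∀ x, 0 ≤ x → 0 ≤ f x) (hf : MonotoneOn f (Ici 0) ∨ AntitoneOn f (Ici 0)) :
    m.TendstoZero P atTop (fun t ω => gammaRatio Γ f t ω - 1) ↔
      m.TendstoZero P atTop
        (fun n ω => gammaIntegral Γ f (n : ℕ) ω / weightSum (fun k => f k) n - 1) := by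
  have hw (k : ℕ) : 0 ≤ f k := hf0 k k.cast_nonneg
  have mΓ := hΓ.aemeasurable_gammaIntegral hf0 hf
  have hΛ := hW.isEquivalent_integral hf0 hf
  constructor <;> intro h
  · have h_nat : m.TendstoZero P atTop
        (fun (n : ℕ) ω => gammaIntegral Γ f n ω / (∫ x in (0 : ℝ)..n, f x) - 1) :=
      h.comp tendsto_natCast_atTop_atTop
    exact h_nat.div_sub_one_of_isEquivalent hΛ fun n => mΓ n
  · have h_nat := h.div_sub_one_of_isEquivalent hΛ.symm fun n => mΓ n
    have hΛ_pos : ∀ᶠ n : ℕ in atTop, 0 < ∫ x in (0 : ℝ)..n, f x :=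
      (hΛ.symm.tendsto_atTop (hW.tendsto_weightSum hw)).eventually_gt_atTop 0
    have hΛ_succ : (fun n : ℕ => ∫ x in (0 : ℝ)..(n + 1), f x) ~[atTop]
        fun n : ℕ => ∫ x in (0 : ℝ)..n, f x := by
      simpa [Function.comp_def] using ((hΛ.comp_tendsto (tendsto_add_atTop_nat 1)).trans
        (hW.isEquivalent_weightSum_succ hw)).trans hΛ.symm
    exact h_nat.div_sub_one_of_monotoneOn (Λ := fun t => ∫ x in (0 : ℝ)..t, f x) mΓ
      (ae_of_all _ (monotoneOn_gammaIntegral Γ hf0 hf))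
      (ae_of_all _ fun ω t => gammaIntegral_nonneg Γ hf0 t ω) (monotoneOn_intervalIntegral hf0 hf)
      hΛ_pos hΛ_succ

theorem div_weightSum_sub_one_le (hw : ∀ k, 0 ≤ w k) {a b : ℝ} (hab : a ≤ b) (n : ℕ) :
    a / weightSum w n - 1 ≤ b / weightSum w n - 1 :=
  sub_le_sub_right (div_le_div_of_nonneg_right hab (weightSum_nonneg hw n)) 1

theorem NegligibleWeights.tendstoZero_weightedRatio_of_gammaIntegral [IsProbabilityMeasure P]
    (hW : NegligibleWeights fun k => f k) (hΓ : IsGammaProcess Γ P)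
    (hf0 : ∀ x, 0 ≤ x → 0 ≤ f x) (hf : MonotoneOn f (Ici 0) ∨ AntitoneOn f (Ici 0))
    (h : m.TendstoZero P atTop
      (fun n ω => gammaIntegral Γ f (n : ℕ) ω / weightSum (fun k => f k) n - 1)) :
    m.TendstoZero P atTop
      (fun n ω => weightedRatio (fun k => f k) (unitIncrement Γ) n ω - 1) := by
  have hw (k : ℕ) : 0 ≤ f k := hf0 k k.cast_nonneg
  have hξ := hΓ.isIIDStdExponential_unitIncrement
  have h_succ := (hW.tendstoZero_div_sub_one_iff_succ hw
    (fun n => hΓ.aemeasurable_gammaIntegral hf0 hf n)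
    fun p hp => (hξ.memLp 0 hp).const_mul (f 0)).1 h
  rcases hf with hf | hf
  · refine hξ.tendstoZero_weightedRatio_sub_one_of_le hξ.shift h h_succ ?_ ?_ <;>
      filter_upwards [hΓ.path] with ω hω n
    · exact div_weightSum_sub_one_le hw (gammaIntegral_sandwich_of_monotoneOn hω hf n).1 n
    · exact div_weightSum_sub_one_le hw (gammaIntegral_sandwich_of_monotoneOn hω hf n).2 n
  · refine hξ.shift.tendstoZero_weightedRatio_sub_one hξ
      (hξ.shift.tendstoZero_weightedRatio_sub_one_of_le hξ h_succ h ?_ ?_) <;>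
      filter_upwards [hΓ.path] with ω hω n
    · exact div_weightSum_sub_one_le hw (gammaIntegral_sandwich_of_antitoneOn hω hf n).2 n
    · exact div_weightSum_sub_one_le hw (gammaIntegral_sandwich_of_antitoneOn hω hf n).1 n

theorem NegligibleWeights.tendstoZero_gammaIntegral_of_weightedRatio [IsProbabilityMeasure P]
    (hW : NegligibleWeights fun k => f k) (hΓ : IsGammaProcess Γ P)
    (hf0 : ∀ x, 0 ≤ x → 0 ≤ f x) (hf : MonotoneOn f (Ici 0) ∨ AntitoneOn f (Ici 0))
    (h : m.TendstoZero P atTop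
      (fun n ω => weightedRatio (fun k => f k) (unitIncrement Γ) n ω - 1)) :
    m.TendstoZero P atTop
      (fun n ω => gammaIntegral Γ f (n : ℕ) ω / weightSum (fun k => f k) n - 1) := by
  have hw (k : ℕ) : 0 ≤ f k := hf0 k k.cast_nonneg
  have hξ := hΓ.isIIDStdExponential_unitIncrement
  have hξ₁ (p : ℝ≥0∞) (hp : p ≠ ∞) : MemLp (fun ω => f 0 * unitIncrement Γ 1 ω) p P :=
    (hξ.memLp 0 hp).const_mul (f 0)
  have mS := hξ.aemeasurable_weightedSum fun k => f k
  have h_shift := hξ.tendstoZero_weightedRatio_sub_one hξ.shift h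
  have h_succ := (hW.tendstoZero_div_sub_one_iff_succ hw mS hξ₁).1 h
  have m_shift (n : ℕ) := ((hξ.shift.aemeasurable_weightedSum (fun k => f k) n).div_const
    (weightSum (fun k => f k) n)).sub_const 1
  have m_succ (n : ℕ) := (((mS (n + 1)).sub ((hξ.aemeasurable 0).const_mul (f 0))).div_const
    (weightSum (fun k => f k) n)).sub_const 1
  refine (hW.tendstoZero_div_sub_one_iff_succ hw
    (fun n => hΓ.aemeasurable_gammaIntegral hf0 hf n) hξ₁).2 ?_
  rcases hf with hf | hf
  · refine h_shift.squeeze h_succ m_shift m_succ univ_mem ?_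
    filter_upwards [hΓ.path] with ω hω n _
    have hsandwich := gammaIntegral_sandwich_of_monotoneOn hω hf
    exact ⟨div_weightSum_sub_one_le hw (hsandwich n).2 n,
      div_weightSum_sub_one_le hw (sub_le_sub_right (hsandwich (n + 1)).1 _) n⟩
  · refine h_succ.squeeze h_shift m_succ m_shift univ_mem ?_
    filter_upwards [hΓ.path] with ω hω n _
    have hsandwich := gammaIntegral_sandwich_of_antitoneOn hω hf
    exact ⟨div_weightSum_sub_one_le hw (sub_le_sub_right (hsandwich (n + 1)).1 _) n,
      div_weightSum_sub_one_le hw (hsandwich n).2 n⟩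

theorem tendstoZero_gammaRatio_sub_one_iff [IsProbabilityMeasure P] [IsProbabilityMeasure P']
    (m : ConvMode) (hΓ : IsGammaProcess Γ P) (hY : IsIIDStdExponential Y P')
    (hf0 : ∀ x, 0 ≤ x → 0 ≤ f x) (hf : MonotoneOn f (Ici 0) ∨ AntitoneOn f (Ici 0)) :
    m.TendstoZero P atTop (fun t ω => gammaRatio Γ f t ω - 1) ↔
      m.TendstoZero P' atTop (fun n ω => weightedRatio (fun k => f k) Y n ω - 1) := by
  have hξ := hΓ.isIIDStdExponential_unitIncrement
  by_cases hW : NegligibleWeights fun k => f k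
  · rw [hW.tendstoZero_gammaRatio_sub_one_iff_natCast hΓ hf0 hf]
    exact ⟨fun h => hξ.tendstoZero_weightedRatio_sub_one hY
        (hW.tendstoZero_weightedRatio_of_gammaIntegral hΓ hf0 hf h),
      fun h => hW.tendstoZero_gammaIntegral_of_weightedRatio hΓ hf0 hf
        (hY.tendstoZero_weightedRatio_sub_one hξ h)⟩
  · refine iff_of_false
      (fun h => hΓ.not_tendstoZero_gammaRatio_sub_one hf0 hf hW (h.inMeasure fun t => ?_))
      (fun h => hY.not_tendstoZero_weightedRatio_sub_one (fun k => hf0 k k.cast_nonneg) hW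
        (h.inMeasure fun n => ?_))
    · exact (hΓ.aemeasurable_gammaRatio hf0 hf t).sub_const 1
    · exact ((hY.aemeasurable_weightedSum _ n).div_const _).sub_const 1

end Comparison

theorem mainTheorem1 {Ω Ω' : Type*} [MeasurableSpace Ω] [MeasurableSpace Ω']
    (P : Measure Ω) [IsProbabilityMeasure P] (P' : Measure Ω') [IsProbabilityMeasure P']
    (Γ : ℝ≥0 → Ω → ℝ) (hΓ : IsGammaProcess Γ P)
    (X : ℕ → Ω' → ℝ) (hX : IsIIDStdExponential X P')
    (f : ℝ → ℝ) (hf0 : ∀ x, 0 ≤ x → 0 ≤ f x)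
    (hf : MonotoneOn f (Ici 0) ∨ AntitoneOn f (Ici 0)) :
    -- convergence in probability
    (TendstoInMeasure P (gammaRatio Γ f) atTop (fun _ => 1) ↔
      TendstoInMeasure P' (weightedRatio (fun k => f k) X) atTop (fun _ => 1)) ∧
    -- convergence in `L^p`, `0 < p < ∞`
    (∀ p : ℝ≥0∞, p ≠ 0 → p ≠ ∞ →
      (Tendsto (fun t : ℝ => eLpNorm (fun ω => gammaRatio Γ f t ω - 1) p P) atTop (𝓝 0) ↔
        Tendsto (fun n : ℕ => eLpNorm (fun ω => weightedRatio (fun k => f k) X n ω - 1) p P')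
          atTop (𝓝 0))) ∧
    -- almost sure convergence
    ((∀ᵐ ω ∂P, Tendsto (fun t : ℝ => gammaRatio Γ f t ω) atTop (𝓝 1)) ↔
      (∀ᵐ ω ∂P', Tendsto (fun n : ℕ => weightedRatio (fun k => f k) X n ω) atTop (𝓝 1))) := by
  have hiff (m : ConvMode) := tendstoZero_gammaRatio_sub_one_iff m hΓ hX hf0 hf
  refine ⟨?_, fun p hp0 hp => hiff (.inLp p hp0 hp), ?_⟩
  · simpa only [ConvMode.tendstoZero_inMeasure_iff, tendstoInMeasure_iff_norm, Real.norm_eq_abs]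
      using hiff .inMeasure
  · simpa only [ConvMode.TendstoZero, tendsto_sub_nhds_zero_iff] using hiff .ae
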